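/- Let $1<\alpha\le 2$, $T,N\in\mathbb N$, $\vec a(0),\dots,\vec a(N)\in\mathbb C^T$, $A_N(e^{i\theta})=\sum_{j=0}^N\vec a(j)e^{ij\theta}$, and write $z^{<\beta>}=|z|^{\beta-1}\bar z$ (componentwise for vectors). A $T\times T$ matrix function $f$ on $[-\pi,\pi]$ is a *spectral density* if it is the density of the (finite) matrix spectral measure of a $\mathbb C^T$-valued symmetric $\alpha$-stable process $\vec Z$ on $[-\pi,\pi]$ with independent increments, that is, $[\int \vec x^{\top}d\vec Z,\int\vec y^{\top}d\vec Z]_\alpha=\int_{-\pi}^{\pi}\vec x(\theta)^{\top}f(\theta)\,\vec y(\theta)^{<\alpha-1>}\,d\theta$ for all bounded measurable $\vec x,\vec y$, where $[\cdot,\cdot]_\alpha$ is the covariation; a harmonizable symmetric $\alpha$-stable sequence $\vec\xi(n)=\int_{-\pi}^{\pi}e^{in\theta}d\vec Z(\theta)$ then has spectral density $f$. Let $\|X\|_\alpha^\alpha=[X,X]_\alpha$. For a spectral density $w$ let $L^\alpha(w)$ be the space of vector functions $h$ with $\int_{-\pi}^{\pi}h^{\top}w\,h^{<\alpha-1>}d\theta<\infty$,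 normed by the $\alpha$-th root of this integral, and let $L^\alpha_N(w)$ be the closed linear span in it of the functions $e^{ij\theta}\delta_k$, $k=1,\dots,T$, $j\in\mathbb Z\setminus\{0,\dots,N\}$. Put $$\Delta(h;f,g)=\int_{-\pi}^{\pi}(A_N-h)^{\top}f\,(A_N-h)^{<\alpha-1>}d\theta+\int_{-\pi}^{\pi}h^{\top}g\,h^{<\alpha-1>}d\theta,\qquad \Delta(f,g)=\inf_{h\in L^\alpha_N(f+g)}\Delta(h;f,g).$$ Let $D_f,D_g$ be sets of spectral densities and $H_D=\bigcap_{(f,g)\in D_f\times D_g}L^\alpha_N(f+g)$. Let $\vec\xi,\vec\eta$ be mutually independent $\mathbb C^T$-valued harmonizable symmetric $\alpha$-stable sequences with spectral densities $f_0\in D_f$, $g_0\in D_g$ satisfying the minimality condition $\int_{-\pi}^{\pi}\mathrm{Tr}[(f_0+g_0)^{-1/(\alpha-1)}]\,d\theta<\infty$ (with $f_0+g_0$ positive definite almost everywhere). Let $h^0=h(f_0,g_0)\in L^\alpha_N(f_0+g_0)$ be the spectral characteristic of the optimal linear estimate $\hat A_N\vec\xi=\int (h^0)^{\top}(d\vec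 Z^{\xi}+d\vec Z^{\eta})$ of $A_N\vec\xi=\sum_{j=0}^N\vec a(j)^{\top}\vec\xi(j)$, i.e. of a point of the $\|\cdot\|_\alpha$-closed linear span of $\{\xi_k(j)+\eta_k(j): 1\le k\le T,\ j\in\mathbb Z\setminus\{0,\dots,N\}\}$ at least $\|\cdot\|_\alpha$-distance from $A_N\vec\xi$. Suppose that $(f_0,g_0)$ solves the constrained problem $$\max_{(f,g)\in D_f\times D_g}\Delta(h^0;f,g)=\Delta(h^0;f_0,g_0)$$ and that $h^0\in H_D$. Then: 1. $f_0,g_0$ are least favorable in $D_f\times D_g$: $\Delta(h^0;f_0,g_0)=\Delta(f_0,g_0)=\max_{(f,g)\in D_f\times D_g}\Delta(f,g)$; 2. $h^0$ is a minimax (robust) spectral characteristic: $h^0\in H_D$, $\max_{(f,g)\in D_f\times D_g}\Delta(h^0;f,g)$ exists, and it equals $\min_{h\in H_D}\sup_{(f,g)\in D_f\times D_g}\Delta(h;f,g)$. -/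

import Mathlib

open MeasureTheory ProbabilityTheory Filter Topology
open scoped ENNReal Matrix ComplexConjugate ComplexOrder

noncomputable section

namespace HSaS

/-! ### Symmetric stable variables and their covariation norm -/

/-- The signed power `z^{<β>} = |z|^{β-1} z̄`. -/
def spow (β : ℝ) (z : ℂ) : ℂ := ((‖z‖ ^ (β - 1) : ℝ) : ℂ) * conj z

/-- `Γ` is the spectral measure of the symmetric `α`-stable complex variable `X`: a finite symmetric
measure on the unit circle with `E exp(i Re(zX)) = exp(-∫ |Re(zs)|^α dΓ(s))` for all complex `z`
(this is the characteristic function of the pair `(Re X, Im X)`). -/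
structure IsSpectralMeasure {Ω : Type*} [MeasurableSpace Ω] (α : ℝ) (P : Measure Ω) (X : Ω → ℂ)
    (Γ : Measure ℂ) : Prop where
  finite : IsFiniteMeasure Γ
  sphere : ∀ᵐ s ∂Γ, ‖s‖ = 1
  symm : Γ.map (fun s => -s) = Γ
  charFun_eq : ∀ z : ℂ, ∫ ω, Complex.exp (Complex.I * ((z * X ω).re : ℂ)) ∂P
    = Complex.exp (-((∫ s, |(z * s).re| ^ α ∂Γ : ℝ) : ℂ))

/-- `‖X‖_α^α = [X, X]_α = ∫ s s^{<α-1>} dΓ(s) = ∫ |s|^α dΓ(s)` with `Γ` the spectral measure of `X`.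
All spectral measures of `X` give the same value; it is `⊤` if `X` is not symmetric `α`-stable. -/
def stableNormPow {Ω : Type*} [MeasurableSpace Ω] (α : ℝ) (P : Measure Ω) (X : Ω → ℂ) : ℝ≥0∞ :=
  ⨅ (Γ : Measure ℂ) (_ : IsSpectralMeasure α P X Γ), ∫⁻ s, ENNReal.ofReal (‖s‖ ^ α) ∂Γ

/-! ### Harmonizable sequences and matrix spectral densities -/

/-- `xᵀ M y^{<α-1>}`, the power being taken componentwise. -/
def covForm {T : ℕ} (α : ℝ) (M : Matrix (Fin T) (Fin T) ℂ) (x y : Fin T → ℂ) : ℂ :=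
  x ⬝ᵥ (M *ᵥ fun k => spow (α - 1) (y k))

/-- The matrix function `f` is the density of the matrix spectral measure of a vector-valued
symmetric `α`-stable process `Z` on `[-π, π]` with independent increments whose law is given by the
finite measure `Γ` on `[-π, π] × (unit sphere of ℂ^T)`:
`E exp(i Re ∫ xᵀ dZ) = exp(-∫ |Re(x(θ)ᵀ s)|^α dΓ(θ, s))`.
The left side of `covariation` is `[∫ xᵀ dZ, ∫ yᵀ dZ]_α`, so the identity reads
`[∫ xᵀ dZ, ∫ yᵀ dZ]_α = ∫ xᵀ f y^{<α-1>} dθ`. -/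
structure IsDensityOf {T : ℕ} (α : ℝ) (Γ : Measure (ℝ × (Fin T → ℂ)))
    (f : ℝ → Matrix (Fin T) (Fin T) ℂ) : Prop where
  finite : IsFiniteMeasure Γ
  sphere : ∀ᵐ p ∂Γ, p.1 ∈ Set.Icc (-Real.pi) Real.pi ∧ ∑ k, ‖p.2 k‖ ^ 2 = 1
  symm : Γ.map (fun p => (p.1, -p.2)) = Γ
  integrable : ∀ k l, IntegrableOn (fun θ => f θ k l) (Set.Icc (-Real.pi) Real.pi)
  covariation : ∀ x y : ℝ → Fin T → ℂ, Measurable x → Measurable y →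
    (∃ C : ℝ, ∀ θ k, ‖x θ k‖ ≤ C) → (∃ C : ℝ, ∀ θ k, ‖y θ k‖ ≤ C) →
    ∫ p, (x p.1 ⬝ᵥ p.2) * spow (α - 1) (y p.1 ⬝ᵥ p.2) ∂Γ
      = ∫ θ in Set.Icc (-Real.pi) Real.pi, covForm α (f θ) (x θ) (y θ)

/-- `f` is the spectral density of some vector-valued symmetric `α`-stable process on `[-π, π]` with
independent increments and finite spectral measure. -/
def IsSpectralDensity {T : ℕ} (α : ℝ) (f : ℝ → Matrix (Fin T) (Fin T) ℂ) : Prop :=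
  ∃ Γ : Measure (ℝ × (Fin T → ℂ)), IsDensityOf α Γ f

/-- The vector trigonometric polynomial `∑ⱼ c(j) e^{ijθ}`. -/
def trigPoly {T : ℕ} (c : ℤ →₀ (Fin T → ℂ)) (θ : ℝ) : Fin T → ℂ :=
  ∑ j ∈ c.support, Complex.exp (Complex.I * ((j * θ : ℝ) : ℂ)) • c j

/-- The random variable `∑ⱼ c(j)ᵀ ζ(j)`. -/
def linComb {Ω : Type*} {T : ℕ} (c : ℤ →₀ (Fin T → ℂ)) (ζ : ℤ → Ω → Fin T → ℂ) (ω : Ω) : ℂ :=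
  ∑ j ∈ c.support, c j ⬝ᵥ ζ j ω

/-- `ξ` is a vector-valued harmonizable symmetric `α`-stable sequence with spectral density `f`: its
finite-dimensional laws are those of `ξ(n) = ∫ e^{inθ} dZ(θ)` for a process `Z` as in
`IsDensityOf`. -/
def IsHarmonizable {Ω : Type*} [MeasurableSpace Ω] {T : ℕ} (α : ℝ) (P : Measure Ω)
    (ξ : ℤ → Ω → Fin T → ℂ) (f : ℝ → Matrix (Fin T) (Fin T) ℂ) : Prop :=
  (∀ n, Measurable (ξ n)) ∧
  ∃ Γ : Measure (ℝ × (Fin T → ℂ)), IsDensityOf α Γ f ∧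
    ∀ c : ℤ →₀ (Fin T → ℂ),
      ∫ ω, Complex.exp (Complex.I * ((linComb c ξ ω).re : ℂ)) ∂P
        = Complex.exp (-((∫ p, |(trigPoly c p.1 ⬝ᵥ p.2).re| ^ α ∂Γ : ℝ) : ℂ))

/-- The minimality condition `∫ Tr[(f + g)^{-1/(α-1)}] dθ < ∞`. -/
def MinimalityCondition {T : ℕ} (α : ℝ) (f g : ℝ → Matrix (Fin T) (Fin T) ℂ) : Prop :=
  (∀ᵐ θ ∂(volume.restrict (Set.Icc (-Real.pi) Real.pi)), (f θ + g θ).PosDef) ∧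
  IntegrableOn
    (fun θ => (Matrix.trace (cfc (fun x : ℝ => x ^ (-1 / (α - 1))) (f θ + g θ))).re)
    (Set.Icc (-Real.pi) Real.pi)

/-! ### The interpolation problem with noise -/

/-- The frequencies (times) `0, 1, …, N` do not occur in `c`. -/
def AvoidsGap {T : ℕ} (N : ℕ) (c : ℤ →₀ (Fin T → ℂ)) : Prop :=
  ∀ j ∈ c.support, j ∉ Set.Icc (0 : ℤ) N

/-- `A_N(e^{iθ}) = ∑_{j=0}^N a(j) e^{ijθ}`. -/
def symbolA {T : ℕ} (N : ℕ) (a : ℕ → Fin T → ℂ) (θ : ℝ) : Fin T → ℂ :=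
  ∑ j ∈ Finset.range (N + 1), Complex.exp (Complex.I * ((j * θ : ℝ) : ℂ)) • a j

/-- `A_N ξ = ∑_{j=0}^N a(j)ᵀ ξ(j)`. -/
def functionalA {Ω : Type*} {T : ℕ} (N : ℕ) (a : ℕ → Fin T → ℂ) (ξ : ℤ → Ω → Fin T → ℂ)
    (ω : Ω) : ℂ :=
  ∑ j ∈ Finset.range (N + 1), a j ⬝ᵥ ξ j ω

/-- `Y` belongs to `H^N(ζ)`, the `‖·‖_α`-closed linear span of the `ζ_k(j)`,
`j ∈ ℤ \ {0, …, N}`. -/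
def IsLinearEstimate {Ω : Type*} [MeasurableSpace Ω] {T : ℕ} (α : ℝ) (P : Measure Ω) (N : ℕ)
    (ζ : ℤ → Ω → Fin T → ℂ) (Y : Ω → ℂ) : Prop :=
  Measurable Y ∧ ∃ c : ℕ → (ℤ →₀ (Fin T → ℂ)), (∀ m, AvoidsGap N (c m)) ∧
    Tendsto (fun m => stableNormPow α P (fun ω => linComb (c m) ζ ω - Y ω)) atTop (𝓝 0)

/-- `Y` is the optimal linear estimate of `A_N ξ` from the observations `ξ(j) + η(j)`,
`j ∈ ℤ \ {0, …, N}`: a projection of `A_N ξ` on `H^N(ξ + η)`. -/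
def IsOptimalEstimate {Ω : Type*} [MeasurableSpace Ω] {T : ℕ} (α : ℝ) (P : Measure Ω) (N : ℕ)
    (a : ℕ → Fin T → ℂ) (ξ η : ℤ → Ω → Fin T → ℂ) (Y : Ω → ℂ) : Prop :=
  IsLinearEstimate α P N (ξ + η) Y ∧
  ∀ Y', IsLinearEstimate α P N (ξ + η) Y' →
    stableNormPow α P (fun ω => functionalA N a ξ ω - Y ω)
      ≤ stableNormPow α P (fun ω => functionalA N a ξ ω - Y' ω)

/-- `∫ hᵀ w h^{<α-1>} dθ`, the `α`-th power of the norm of `L^α(w)`. For a spectral density `w` the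
integrand is real and nonnegative almost everywhere. -/
def normPow {T : ℕ} (α : ℝ) (w : ℝ → Matrix (Fin T) (Fin T) ℂ) (h : ℝ → Fin T → ℂ) : ℝ≥0∞ :=
  ∫⁻ θ in Set.Icc (-Real.pi) Real.pi, ENNReal.ofReal (covForm α (w θ) (h θ) (h θ)).re

/-- `L_N^α(w)`: the closed linear span in `L^α(w)` of the functions `e^{ijθ} δ_k`,
`j ∈ ℤ \ {0, …, N}`. -/
def estimateSpace {T : ℕ} (α : ℝ) (N : ℕ) (w : ℝ → Matrix (Fin T) (Fin T) ℂ) :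
    Set (ℝ → Fin T → ℂ) :=
  {h | Measurable h ∧ ∃ c : ℕ → (ℤ →₀ (Fin T → ℂ)), (∀ m, AvoidsGap N (c m)) ∧
    Tendsto (fun m => normPow α w (fun θ => trigPoly (c m) θ - h θ)) atTop (𝓝 0)}

/-- `h` is the spectral characteristic of the estimate `Y ∈ H^N(ξ + η)`, that is,
`Y = ∫ hᵀ (dZ^ξ + dZ^η)`: `Y` and `h` correspond to each other under the extension by continuity of
`ξ_k(j) + η_k(j) ↔ e^{ijθ} δ_k`. -/
def IsCharacteristicOf {Ω : Type*} [MeasurableSpace Ω] {T : ℕ} (α : ℝ) (P : Measure Ω) (N : ℕ)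
    (ξ η : ℤ → Ω → Fin T → ℂ) (f g : ℝ → Matrix (Fin T) (Fin T) ℂ) (Y : Ω → ℂ)
    (h : ℝ → Fin T → ℂ) : Prop :=
  Measurable h ∧ ∃ c : ℕ → (ℤ →₀ (Fin T → ℂ)), (∀ m, AvoidsGap N (c m)) ∧
    Tendsto (fun m => stableNormPow α P (fun ω => linComb (c m) (ξ + η) ω - Y ω)) atTop (𝓝 0) ∧
    Tendsto (fun m => normPow α (f + g) (fun θ => trigPoly (c m) θ - h θ)) atTop (𝓝 0)

/-- `h = h(f, g)`: the spectral characteristic of the optimal linear estimate of `A_N ξ`. -/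
def IsOptimalCharacteristic {Ω : Type*} [MeasurableSpace Ω] {T : ℕ} (α : ℝ) (P : Measure Ω) (N : ℕ)
    (a : ℕ → Fin T → ℂ) (ξ η : ℤ → Ω → Fin T → ℂ) (f g : ℝ → Matrix (Fin T) (Fin T) ℂ)
    (h : ℝ → Fin T → ℂ) : Prop :=
  ∃ Y : Ω → ℂ, IsOptimalEstimate α P N a ξ η Y ∧ IsCharacteristicOf α P N ξ η f g Y h

/-! ### Minimax notions -/

/-- `Δ(h; f, g) = ∫ (A_N - h)ᵀ f (A_N - h)^{<α-1>} dθ + ∫ hᵀ g h^{<α-1>} dθ`. -/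
def estError {T : ℕ} (α : ℝ) (N : ℕ) (a : ℕ → Fin T → ℂ) (h : ℝ → Fin T → ℂ)
    (f g : ℝ → Matrix (Fin T) (Fin T) ℂ) : ℝ≥0∞ :=
  normPow α f (fun θ => symbolA N a θ - h θ) + normPow α g h

/-- `Δ(f, g) = Δ(h(f, g); f, g)`, the least value of `Δ(h; f, g)` for `h ∈ L_N^α(f + g)`. -/
def optimalError {T : ℕ} (α : ℝ) (N : ℕ) (a : ℕ → Fin T → ℂ)
    (f g : ℝ → Matrix (Fin T) (Fin T) ℂ) : ℝ≥0∞ :=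
  ⨅ h ∈ estimateSpace α N (f + g), estError α N a h f g

/-- `H_D`, the intersection of the spaces `L_N^α(f + g)` over `(f, g) ∈ D_f × D_g`. -/
def commonSpace {T : ℕ} (α : ℝ) (N : ℕ) (Df Dg : Set (ℝ → Matrix (Fin T) (Fin T) ℂ)) :
    Set (ℝ → Fin T → ℂ) :=
  {h | ∀ f ∈ Df, ∀ g ∈ Dg, h ∈ estimateSpace α N (f + g)}

/-- `(f₀, g₀)` solves the constrained problem
`max_{(f, g) ∈ D_f × D_g} Δ(h₀; f, g) = Δ(h₀; f₀, g₀)`. -/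
def SolvesConstrained {T : ℕ} (α : ℝ) (N : ℕ) (a : ℕ → Fin T → ℂ)
    (Df Dg : Set (ℝ → Matrix (Fin T) (Fin T) ℂ)) (h₀ : ℝ → Fin T → ℂ)
    (f₀ g₀ : ℝ → Matrix (Fin T) (Fin T) ℂ) : Prop :=
  f₀ ∈ Df ∧ g₀ ∈ Dg ∧ ∀ f ∈ Df, ∀ g ∈ Dg, estError α N a h₀ f g ≤ estError α N a h₀ f₀ g₀

/-- `f₀ ∈ D_f`, `g₀ ∈ D_g` are least favorable in `D_f × D_g`. -/
def IsLeastFavorable {T : ℕ} (α : ℝ) (N : ℕ) (a : ℕ → Fin T → ℂ)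
    (Df Dg : Set (ℝ → Matrix (Fin T) (Fin T) ℂ)) (f₀ g₀ : ℝ → Matrix (Fin T) (Fin T) ℂ) : Prop :=
  f₀ ∈ Df ∧ g₀ ∈ Dg ∧ ∀ f ∈ Df, ∀ g ∈ Dg, optimalError α N a f g ≤ optimalError α N a f₀ g₀

/-- `sup_{(f, g) ∈ D_f × D_g} Δ(h; f, g)`. -/
def worstError {T : ℕ} (α : ℝ) (N : ℕ) (a : ℕ → Fin T → ℂ)
    (Df Dg : Set (ℝ → Matrix (Fin T) (Fin T) ℂ)) (h : ℝ → Fin T → ℂ) : ℝ≥0∞ :=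
  ⨆ f ∈ Df, ⨆ g ∈ Dg, estError α N a h f g

/-- `h₀` is a minimax (robust) spectral characteristic: `h₀ ∈ H_D`, the maximum of `Δ(h₀; f, g)` over
`D_f × D_g` is attained, and `h₀` minimizes the worst error over `H_D`. -/
def IsMinimaxCharacteristic {T : ℕ} (α : ℝ) (N : ℕ) (a : ℕ → Fin T → ℂ)
    (Df Dg : Set (ℝ → Matrix (Fin T) (Fin T) ℂ)) (h₀ : ℝ → Fin T → ℂ) : Prop :=
  h₀ ∈ commonSpace α N Df Dg ∧
  (∃ f ∈ Df, ∃ g ∈ Dg, worstError α N a Df Dg h₀ = estError α N a h₀ f g) ∧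
  ∀ h ∈ commonSpace α N Df Dg, worstError α N a Df Dg h₀ ≤ worstError α N a Df Dg h

end HSaS

end

namespace HSaS

/-! ### `L^α` functionals -/

/-! The minimax conclusions are a saddle point argument: once `h₀` is known to minimize `Δ(·; f₀,
g₀)` over `L_N^α(f₀ + g₀)`, they follow by comparing infima and suprema. The work lies in that
minimality (`IsOptimalCharacteristic.estError_le`), because optimality is assumed for random
variables and the `‖·‖_α` distance, whereas `Δ` is an integral against spectral densities.

Two identifications connect them. First, `∫ xᵀ f x^{<α-1>} dθ = ∫ |xᵀ s|^α dΓ` for every measurable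
`x` (`IsDensityOf.normPow_eq`), so the form attached to a density inherits the triangle inequality
and continuity of a genuine `L^α` space. Second, suppose that the characteristic exponent of `X` is
`∫ |Re(z xᵀ s)|^α dΓ + ∫ |Re(z yᵀ s)|^α dΓ'`, with both functions of finite norm. Then `‖X‖_α^α = ∫
|xᵀ s|^α dΓ + ∫ |yᵀ s|^α dΓ'`. The bound `≤` comes from an explicit spectral measure
(`stableNormPow_le`). The bound `≥` comes from averaging the exponent over `z` in the unit disc
(`le_stableNormPow`), which replaces uniqueness of the spectral measure.

By independence, the error of a polynomial estimate has such an exponent, with `x = A_N - p` and `y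
= p`. For the optimal estimate `Y` the exponent is obtained as a limit, since convergence in `‖·‖_α`
implies convergence of characteristic functions. Competitors `h` are reached by approximation with
polynomials. -/

theorem tendsto_lintegral_rpow_enorm {E F : Type*} [MeasurableSpace E] [NormedAddCommGroup F]
    {μ : Measure E} {α : ℝ} (hα : 1 ≤ α) {v : ℕ → E → F} {w : E → F}
    (hv : ∀ m, AEStronglyMeasurable (v m) μ) (hw : AEStronglyMeasurable w μ)
    (h : Tendsto (fun m => ∫⁻ e, ‖v m e - w e‖ₑ ^ α ∂μ) atTop (𝓝 0)) :
    Tendsto (fun m => ∫⁻ e, ‖v m e‖ₑ ^ α ∂μ) atTop (𝓝 (∫⁻ e, ‖w e‖ₑ ^ α ∂μ)) := by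
  have hα0 : 0 < α := by linarith
  have key : ∀ u : E → F, ∫⁻ e, ‖u e‖ₑ ^ α ∂μ = eLpNorm' u α μ ^ α := fun u => by
    rw [eLpNorm', ← ENNReal.rpow_mul, one_div, inv_mul_cancel₀ hα0.ne', ENNReal.rpow_one]
  have herr : Tendsto (fun m => eLpNorm' (v m - w) α μ) atTop (𝓝 0) := by
    have := h.ennrpow_const (1 / α)
    rw [ENNReal.zero_rpow_of_pos (by positivity)] at this
    exact this
  simp only [key]
  refine Tendsto.ennrpow_const α ?_
  have hlow : Tendsto (fun m => eLpNorm' w α μ - eLpNorm' (v m - w) α μ) atTop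
      (𝓝 (eLpNorm' w α μ)) := by
    simpa using ENNReal.Tendsto.sub (tendsto_const_nhds (x := eLpNorm' w α μ)) herr
      (Or.inr ENNReal.zero_ne_top)
  have hupp : Tendsto (fun m => eLpNorm' w α μ + eLpNorm' (v m - w) α μ) atTop
      (𝓝 (eLpNorm' w α μ)) := by
    simpa using (tendsto_const_nhds (x := eLpNorm' w α μ)).add herr
  refine tendsto_of_tendsto_of_tendsto_of_le_of_le hlow hupp (fun m => ?_) fun m => ?_
  · rw [tsub_le_iff_right]
    have := eLpNorm'_add_le (f := v m) (g := w - v m) (hv m) (hw.sub (hv m)) hα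
    rw [add_sub_cancel] at this
    have hneg : eLpNorm' (w - v m) α μ = eLpNorm' (v m - w) α μ := by
      rw [← neg_sub, eLpNorm'_neg]
    rwa [hneg] at this
  · have := eLpNorm'_add_le (f := w) (g := v m - w) hw ((hv m).sub hw) hα
    rwa [add_sub_cancel] at this

/-! ### Averaging over rotations -/

theorem enorm_re_le (z : ℂ) : ‖z.re‖ₑ ≤ ‖z‖ₑ := by
  rw [enorm_le_iff_norm_le]; exact Complex.abs_re_le_norm z

/-- The average of `|Re z|^α` over the unit disc. -/
noncomputable def discConst (α : ℝ) : ℝ≥0∞ := ∫⁻ z in Metric.ball (0 : ℂ) 1, ‖z.re‖ₑ ^ α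

theorem discConst_ne_top {α : ℝ} (hα : 0 ≤ α) : discConst α ≠ ⊤ := by
  refine ((setLIntegral_mono (g := fun _ => (1 : ℝ≥0∞)) measurable_const
    fun z hz => ?_).trans_lt ?_).ne
  · refine ENNReal.rpow_le_one ((enorm_re_le z).trans ?_) hα
    have : ‖z‖ ≤ 1 := by simpa using (mem_ball_zero_iff.1 hz).le
    simpa using (enorm_le_iff_norm_le (x := z) (y := (1 : ℂ))).2 (by simpa using this)
  · simp

theorem discConst_ne_zero {α : ℝ} (hα : 0 < α) : discConst α ≠ 0 := by
  have hm : Measurable fun z : ℂ => ‖z.re‖ₑ ^ α := by fun_prop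
  refine (setLIntegral_pos_iff hm).2 ?_ |>.ne'
  have hopen : IsOpen ({z : ℂ | z.re ≠ 0} ∩ Metric.ball 0 1) :=
    (isOpen_ne_fun Complex.continuous_re continuous_const).inter Metric.isOpen_ball
  have hpos := hopen.measure_pos volume ⟨(1 / 2 : ℂ), by
    constructor
    · norm_num
    · rw [mem_ball_zero_iff]; norm_num⟩
  refine hpos.trans_le (measure_mono (Set.inter_subset_inter_left _ fun z hz => ?_))
  simp only [Set.mem_ofPred_eq] at hz
  simp [Function.mem_support, ENNReal.rpow_eq_zero_iff, hz, hα]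

/-- Multiplication by `w` is a rotation followed by scaling by `‖w‖`; area on the disc is rotation
invariant and `|Re ·|^α` is homogeneous of degree `α`. -/
theorem lintegral_disc_re_mul {α : ℝ} (hα : 0 < α) (w : ℂ) :
    ∫⁻ z in Metric.ball (0 : ℂ) 1, ‖(z * w).re‖ₑ ^ α = ‖w‖ₑ ^ α * discConst α := by
  rcases eq_or_ne w 0 with rfl | hw
  · simp [hα]
  have hu : ‖w / ‖w‖‖ = 1 := by simp [hw]
  let u : Circle := ⟨w / ‖w‖, mem_sphere_zero_iff_norm.2 hu⟩
  have hwu : w = (‖w‖ : ℂ) * u := by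
    have : (‖w‖ : ℂ) ≠ 0 := by simpa using hw
    change w = (‖w‖ : ℂ) * (w / ‖w‖)
    field_simp
  have hmp := (rotation u).measurePreserving
  have hball : (rotation u) ⁻¹' Metric.ball (0 : ℂ) 1 = Metric.ball 0 1 := by
    ext z; rw [Set.mem_preimage, mem_ball_zero_iff, mem_ball_zero_iff, LinearIsometryEquiv.norm_map]
  calc ∫⁻ z in Metric.ball (0 : ℂ) 1, ‖(z * w).re‖ₑ ^ α
      = ∫⁻ z in Metric.ball (0 : ℂ) 1, ‖w‖ₑ ^ α * ‖(rotation u z).re‖ₑ ^ α := by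
        refine lintegral_congr fun z => ?_
        rw [← ENNReal.mul_rpow_of_nonneg _ _ hα.le]
        congr 1
        have : z * w = (‖w‖ : ℂ) * (rotation u z) := by
          rw [rotation_apply]; nth_rewrite 1 [hwu]; ring
        rw [this, Complex.re_ofReal_mul, enorm_mul]
        simp
    _ = ‖w‖ₑ ^ α * ∫⁻ z in Metric.ball (0 : ℂ) 1, ‖(rotation u z).re‖ₑ ^ α := by
        rw [lintegral_const_mul _ (by fun_prop)]
    _ = ‖w‖ₑ ^ α * discConst α := by
        rw [discConst, ← hmp.setLIntegral_comp_preimage Metric.isOpen_ball.measurableSet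
          (f := fun z : ℂ => ‖z.re‖ₑ ^ α) (by fun_prop), hball]

/-- By Tonelli, the values of a stable exponent at all `z` determine `∫ |u|^α`, up to a constant
that is neither zero nor infinite. -/
theorem lintegral_disc_lintegral {E : Type*} [MeasurableSpace E] {μ : Measure E} [SFinite μ]
    {α : ℝ} (hα : 0 < α) {u : E → ℂ} (hu : Measurable u) :
    ∫⁻ z in Metric.ball (0 : ℂ) 1, ∫⁻ e, ‖(z * u e).re‖ₑ ^ α ∂μ
      = (∫⁻ e, ‖u e‖ₑ ^ α ∂μ) * discConst α := by
  rw [lintegral_lintegral_swap (by fun_prop)]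
  simp_rw [lintegral_disc_re_mul hα]
  rw [lintegral_mul_const _ (by fun_prop)]

theorem lintegral_re_mul_le {E : Type*} [MeasurableSpace E] {μ : Measure E}
    {α : ℝ} (hα : 0 ≤ α) (u : E → ℂ) (z : ℂ) :
    ∫⁻ e, ‖(z * u e).re‖ₑ ^ α ∂μ ≤ ‖z‖ₑ ^ α * ∫⁻ e, ‖u e‖ₑ ^ α ∂μ := by
  rw [← lintegral_const_mul' _ _ (ENNReal.rpow_ne_top_of_nonneg hα enorm_ne_top)]
  refine lintegral_mono fun e => ?_
  rw [← ENNReal.mul_rpow_of_nonneg _ _ hα, ← enorm_mul]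
  exact ENNReal.rpow_le_rpow (enorm_re_le _) hα

theorem tendsto_lintegral_re_mul {E : Type*} [MeasurableSpace E] {μ : Measure E} {α : ℝ}
    (hα : 1 ≤ α) {v : ℕ → E → ℂ} {w : E → ℂ} (hv : ∀ m, Measurable (v m)) (hw : Measurable w)
    (h : Tendsto (fun m => ∫⁻ e, ‖v m e - w e‖ₑ ^ α ∂μ) atTop (𝓝 0)) (z : ℂ) :
    Tendsto (fun m => ∫⁻ e, ‖(z * v m e).re‖ₑ ^ α ∂μ) atTop
      (𝓝 (∫⁻ e, ‖(z * w e).re‖ₑ ^ α ∂μ)) := by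
  have hα0 : 0 ≤ α := by linarith
  refine tendsto_lintegral_rpow_enorm hα (v := fun m e => (z * v m e).re)
    (w := fun e => (z * w e).re)
    (fun m => (Complex.measurable_re.comp ((hv m).const_mul z)).aestronglyMeasurable)
    (Complex.measurable_re.comp (hw.const_mul z)).aestronglyMeasurable ?_
  have hz : ‖z‖ₑ ^ α ≠ ⊤ := ENNReal.rpow_ne_top_of_nonneg hα0 enorm_ne_top
  have hlim : Tendsto (fun m => ‖z‖ₑ ^ α * ∫⁻ e, ‖v m e - w e‖ₑ ^ α ∂μ) atTop (𝓝 0) := by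
    simpa using ENNReal.Tendsto.const_mul h (Or.inr hz)
  refine tendsto_of_tendsto_of_tendsto_of_le_of_le tendsto_const_nhds hlim
    (fun _ => zero_le) fun m => ?_
  refine le_trans (le_of_eq ?_) (lintegral_re_mul_le hα0 (fun e => v m e - w e) z)
  simp only [mul_sub, Complex.sub_re]

theorem integral_abs_rpow_eq {E : Type*} [MeasurableSpace E] {μ : Measure E} {α : ℝ}
    (hα : 0 ≤ α) {r : E → ℝ} (hr : Measurable r) :
    ∫ e, |r e| ^ α ∂μ = (∫⁻ e, ‖r e‖ₑ ^ α ∂μ).toReal := by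
  rw [integral_eq_lintegral_of_nonneg_ae (Eventually.of_forall fun e => by positivity)
    (by fun_prop)]
  congr 1
  refine lintegral_congr fun e => ?_
  rw [← ENNReal.ofReal_rpow_of_nonneg (abs_nonneg _) hα, Real.enorm_eq_ofReal_abs]

theorem ofReal_norm_rpow {α : ℝ} (hα : 0 ≤ α) (s : ℂ) :
    ENNReal.ofReal (‖s‖ ^ α) = ‖s‖ₑ ^ α := by
  rw [← ENNReal.ofReal_rpow_of_nonneg (norm_nonneg _) hα, ofReal_norm]

/-! ### Spectral densities -/

section Density

variable {T : ℕ} {α : ℝ}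

theorem mul_spow_self (hα : 0 < α) (u : ℂ) : u * spow (α - 1) u = ((‖u‖ ^ α : ℝ) : ℂ) := by
  rcases eq_or_ne u 0 with rfl | hu
  · simp [Real.zero_rpow hα.ne']
  · have hn : 0 < ‖u‖ := norm_pos_iff.2 hu
    have h : α = (α - 1 - 1) + 2 := by ring
    calc u * spow (α - 1) u = ((‖u‖ ^ (α - 1 - 1) : ℝ) : ℂ) * (u * conj u) := by
          rw [spow]; ring
      _ = ((‖u‖ ^ α : ℝ) : ℂ) := by
          rw [Complex.mul_conj, Complex.normSq_eq_norm_sq, ← Complex.ofReal_mul]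
          conv_rhs => rw [h, Real.rpow_add hn, Real.rpow_two]

@[fun_prop]
theorem measurable_spow (β : ℝ) : Measurable (spow β) := by
  unfold spow
  exact (Complex.measurable_ofReal.comp (by fun_prop)).mul (by fun_prop)

theorem norm_spow_le (hα : 1 < α) {C : ℝ} {u : ℂ} (hu : ‖u‖ ≤ C) :
    ‖spow (α - 1) u‖ ≤ C ^ (α - 1) := by
  have h : ‖spow (α - 1) u‖ = ‖u‖ ^ (α - 1) := by
    rcases eq_or_ne u 0 with rfl | h0
    · simp [spow, Real.zero_rpow (sub_ne_zero.2 hα.ne')]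
    · have hn : 0 < ‖u‖ := norm_pos_iff.2 h0
      rw [spow, norm_mul, Complex.norm_real, RCLike.norm_conj, Real.norm_of_nonneg (by positivity)]
      nth_rewrite 2 [← Real.rpow_one ‖u‖]
      rw [← Real.rpow_add hn, sub_add_cancel]
  rw [h]
  exact Real.rpow_le_rpow (norm_nonneg _) hu (by linarith)

theorem covForm_indicator (M : Matrix (Fin T) (Fin T) ℂ) (S : Set ℝ) (x : ℝ → Fin T → ℂ) (θ : ℝ) :
    covForm α M (S.indicator x θ) (S.indicator x θ)
      = S.indicator (fun θ => covForm α M (x θ) (x θ)) θ := by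
  by_cases h : θ ∈ S
  · simp [h]
  · simp [h, covForm]

theorem covForm_add (M M' : Matrix (Fin T) (Fin T) ℂ) (x y : Fin T → ℂ) :
    covForm α (M + M') x y = covForm α M x y + covForm α M' x y := by
  simp [covForm, Matrix.add_mulVec, dotProduct_add]

theorem covForm_eq_sum (M : Matrix (Fin T) (Fin T) ℂ) (x y : Fin T → ℂ) :
    covForm α M x y = ∑ k, ∑ l, M k l * (x k * spow (α - 1) (y l)) := by
  simp only [covForm, dotProduct, Matrix.mulVec, Finset.mul_sum]
  refine Finset.sum_congr rfl fun k _ => Finset.sum_congr rfl fun l _ => by ring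

theorem measurable_dotProduct_snd {x : ℝ → Fin T → ℂ} (hx : Measurable x) :
    Measurable fun p : ℝ × (Fin T → ℂ) => x p.1 ⬝ᵥ p.2 := by
  simp only [dotProduct]
  exact Finset.measurable_sum _ fun k _ =>
    ((measurable_pi_apply k).comp (hx.comp measurable_fst)).mul
      ((measurable_pi_apply k).comp measurable_snd)

/-- `∫ |x(θ)ᵀ s|^α dΓ(θ, s)`. -/
noncomputable def spectralPow (α : ℝ) (Γ : Measure (ℝ × (Fin T → ℂ))) (x : ℝ → Fin T → ℂ) : ℝ≥0∞ :=
  ∫⁻ p, ‖x p.1 ⬝ᵥ p.2‖ₑ ^ α ∂Γ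

variable {Γ : Measure (ℝ × (Fin T → ℂ))} {f : ℝ → Matrix (Fin T) (Fin T) ℂ}

theorem IsDensityOf.aestronglyMeasurable_covForm (h : IsDensityOf α Γ f) {x : ℝ → Fin T → ℂ}
    (hx : Measurable x) :
    AEStronglyMeasurable (fun θ => covForm α (f θ) (x θ) (x θ))
      (volume.restrict (Set.Icc (-Real.pi) Real.pi)) := by
  simp only [covForm_eq_sum]
  refine Finset.aestronglyMeasurable_fun_sum _ fun k _ =>
    Finset.aestronglyMeasurable_fun_sum _ fun l _ => (h.integrable k l).1.mul ?_
  exact (((measurable_pi_apply k).comp hx).mul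
    ((measurable_spow _).comp ((measurable_pi_apply l).comp hx))).aestronglyMeasurable

theorem IsDensityOf.aemeasurable_covForm_re (h : IsDensityOf α Γ f) {x : ℝ → Fin T → ℂ}
    (hx : Measurable x) :
    AEMeasurable (fun θ => ENNReal.ofReal (covForm α (f θ) (x θ) (x θ)).re)
      (volume.restrict (Set.Icc (-Real.pi) Real.pi)) :=
  (Complex.measurable_re.comp_aemeasurable
    (h.aestronglyMeasurable_covForm hx).aemeasurable).ennreal_ofReal

theorem IsDensityOf.integrable_covForm (hα : 1 < α) (h : IsDensityOf α Γ f) {x : ℝ → Fin T → ℂ}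
    (hx : Measurable x) {C : ℝ} (hC : ∀ θ k, ‖x θ k‖ ≤ C) :
    IntegrableOn (fun θ => covForm α (f θ) (x θ) (x θ)) (Set.Icc (-Real.pi) Real.pi) := by
  simp only [covForm_eq_sum]
  refine integrable_finsetSum _ fun k _ => integrable_finsetSum _ fun l _ =>
    (h.integrable k l).mul_bdd (c := C * C ^ (α - 1)) ?_ (Eventually.of_forall fun θ => ?_)
  · exact (((measurable_pi_apply k).comp hx).mul
      ((measurable_spow _).comp ((measurable_pi_apply l).comp hx))).aestronglyMeasurable
  · rw [norm_mul]
    exact mul_le_mul (hC θ k) (norm_spow_le hα (hC θ l)) (norm_nonneg _)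
      ((norm_nonneg _).trans (hC θ k))

theorem IsDensityOf.norm_dotProduct_le (h : IsDensityOf α Γ f) {x : ℝ → Fin T → ℂ}
    {C : ℝ} (hC : ∀ θ k, ‖x θ k‖ ≤ C) : ∀ᵐ p ∂Γ, ‖x p.1 ⬝ᵥ p.2‖ ≤ T * C := by
  filter_upwards [h.sphere] with p hp
  have h1 : ∀ k, ‖p.2 k‖ ≤ 1 := fun k => by
    have := Finset.single_le_sum (f := fun k => ‖p.2 k‖ ^ 2) (fun i _ => by positivity)
      (Finset.mem_univ k)
    rw [hp.2] at this
    exact (sq_le_one_iff₀ (norm_nonneg _)).1 this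
  calc ‖x p.1 ⬝ᵥ p.2‖ ≤ ∑ k, ‖x p.1 k * p.2 k‖ := norm_sum_le _ _
    _ ≤ ∑ _k : Fin T, C := Finset.sum_le_sum fun k _ => by
        rw [norm_mul]
        exact (mul_le_of_le_one_right (norm_nonneg _) (h1 k)).trans (hC _ k)
    _ = T * C := by simp

theorem IsDensityOf.spectralPow_lt_top (hα : 0 ≤ α) (h : IsDensityOf α Γ f) {x : ℝ → Fin T → ℂ}
    {C : ℝ} (hC : ∀ θ k, ‖x θ k‖ ≤ C) : spectralPow α Γ x < ⊤ := by
  have := h.finite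
  have hle : spectralPow α Γ x ≤ ∫⁻ _p, ENNReal.ofReal (T * C) ^ α ∂Γ := by
    refine lintegral_mono_ae ?_
    filter_upwards [h.norm_dotProduct_le hC] with p hp
    refine ENNReal.rpow_le_rpow ?_ hα
    rw [← ofReal_norm]
    exact ENNReal.ofReal_le_ofReal hp
  refine hle.trans_lt ?_
  rw [lintegral_const]
  exact ENNReal.mul_lt_top
    (ENNReal.rpow_ne_top_of_nonneg hα ENNReal.ofReal_ne_top).lt_top (measure_lt_top _ _)

/-- Cutting both arguments of the covariation identity to `S` localizes the density side to `S`,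
while the spectral side stays visibly nonnegative because `u u^{<α-1>} = |u|^α`. Nonnegativity over
all `S` then gives it pointwise almost everywhere. -/
theorem IsDensityOf.setIntegral_covForm_re (hα : 1 < α) (h : IsDensityOf α Γ f)
    {x : ℝ → Fin T → ℂ} (hx : Measurable x) {C : ℝ} (hC : ∀ θ k, ‖x θ k‖ ≤ C) {S : Set ℝ}
    (hS : MeasurableSet S) :
    ∫ θ in S, (covForm α (f θ) (x θ) (x θ)).re ∂(volume.restrict (Set.Icc (-Real.pi) Real.pi))
      = ∫ p, ‖S.indicator x p.1 ⬝ᵥ p.2‖ ^ α ∂Γ := by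
  have hC' : ∀ θ k, ‖S.indicator x θ k‖ ≤ C := fun θ k => by
    by_cases hθ : θ ∈ S
    · simpa [hθ] using hC θ k
    · simpa [hθ] using (norm_nonneg _).trans (hC θ k)
  have hcov := h.covariation _ _ (hx.indicator hS) (hx.indicator hS) ⟨C, hC'⟩ ⟨C, hC'⟩
  simp only [mul_spow_self (by linarith : 0 < α), covForm_indicator] at hcov
  rw [integral_complex_ofReal, integral_congr_ae
    (g := S.indicator fun θ => covForm α (f θ) (x θ) (x θ))
    (Eventually.of_forall fun θ => ?_), integral_indicator hS] at hcov
  · have hre := congrArg Complex.re hcov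
    have hint := (h.integrable_covForm hα hx hC).integrable.restrict (s := S)
    have h2 : ∀ φ : ℝ → ℂ, Integrable φ
        ((volume.restrict (Set.Icc (-Real.pi) Real.pi)).restrict S) →
        ∫ θ in S, (φ θ).re ∂(volume.restrict (Set.Icc (-Real.pi) Real.pi))
          = (∫ θ in S, φ θ ∂(volume.restrict (Set.Icc (-Real.pi) Real.pi))).re :=
      fun φ hφ => integral_re hφ
    rw [h2 _ hint, ← hre]
    exact Complex.ofReal_re _
  · by_cases hθ : θ ∈ S <;> simp [hθ]

theorem IsDensityOf.covForm_re_nonneg_of_bounded (hα : 1 < α) (h : IsDensityOf α Γ f)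
    {x : ℝ → Fin T → ℂ} (hx : Measurable x) {C : ℝ} (hC : ∀ θ k, ‖x θ k‖ ≤ C) :
    ∀ᵐ θ ∂(volume.restrict (Set.Icc (-Real.pi) Real.pi)),
      0 ≤ (covForm α (f θ) (x θ) (x θ)).re := by
  refine ae_nonneg_of_forall_setIntegral_nonneg (h.integrable_covForm hα hx hC).re fun S hS _ => ?_
  refine le_of_le_of_eq ?_ (h.setIntegral_covForm_re hα hx hC hS).symm
  exact integral_nonneg fun p => by positivity

theorem IsDensityOf.normPow_eq_of_bounded (hα : 1 < α) (h : IsDensityOf α Γ f)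
    {x : ℝ → Fin T → ℂ} (hx : Measurable x) {C : ℝ} (hC : ∀ θ k, ‖x θ k‖ ≤ C) :
    normPow α f x = spectralPow α Γ x := by
  have hα0 : 0 ≤ α := by linarith
  have hu := h.setIntegral_covForm_re hα hx hC MeasurableSet.univ
  rw [Measure.restrict_univ, Set.indicator_univ] at hu
  have hint : Integrable (fun θ => (covForm α (f θ) (x θ) (x θ)).re)
      (volume.restrict (Set.Icc (-Real.pi) Real.pi)) := (h.integrable_covForm hα hx hC).re
  rw [normPow, ← ofReal_integral_eq_lintegral_ofReal hint
    (h.covForm_re_nonneg_of_bounded hα hx hC)]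
  have hm := measurable_dotProduct_snd hx
  have h1 : ∫ p, ‖x p.1 ⬝ᵥ p.2‖ ^ α ∂Γ = (spectralPow α Γ x).toReal := by
    rw [integral_eq_lintegral_of_nonneg_ae (Eventually.of_forall fun p => by positivity)
      (by fun_prop)]
    simp only [ofReal_norm_rpow hα0, spectralPow]
  refine (congrArg ENNReal.ofReal (hu.trans h1)).trans ?_
  exact ENNReal.ofReal_toReal (h.spectralPow_lt_top hα0 hC).ne

/-- The set on which all components of `x` are bounded by `n`. -/
def boundedSet (x : ℝ → Fin T → ℂ) (n : ℕ) : Set ℝ := {θ | ∀ k, ‖x θ k‖ ≤ n}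

theorem measurableSet_boundedSet {x : ℝ → Fin T → ℂ} (hx : Measurable x) (n : ℕ) :
    MeasurableSet (boundedSet x n) := by
  have : boundedSet x n = ⋂ k, {θ | ‖x θ k‖ ≤ n} := by
    ext; simp [boundedSet]
  rw [this]
  exact MeasurableSet.iInter fun k =>
    measurableSet_le ((measurable_pi_apply k).comp hx).norm measurable_const

theorem boundedSet_mono (x : ℝ → Fin T → ℂ) : Monotone (boundedSet x) :=
  fun _ _ hmn _ hθ k => (hθ k).trans (by exact_mod_cast hmn)

theorem exists_mem_boundedSet (x : ℝ → Fin T → ℂ) (θ : ℝ) : ∃ n, θ ∈ boundedSet x n := by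
  obtain ⟨n, hn⟩ := exists_nat_ge (∑ k, ‖x θ k‖)
  exact ⟨n, fun k => (Finset.single_le_sum (f := fun k => ‖x θ k‖) (fun _ _ => norm_nonneg _)
    (Finset.mem_univ k)).trans hn⟩

theorem norm_indicator_boundedSet_le (x : ℝ → Fin T → ℂ) (n : ℕ) (θ : ℝ) (k : Fin T) :
    ‖(boundedSet x n).indicator x θ k‖ ≤ n := by
  by_cases hθ : θ ∈ boundedSet x n
  · simpa [hθ] using hθ k
  · simp [hθ]

/-- Every `θ` lies in some `boundedSet x n`, so the countably many null sets of the bounded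
truncations suffice. -/
theorem IsDensityOf.covForm_re_nonneg (hα : 1 < α) (h : IsDensityOf α Γ f)
    {x : ℝ → Fin T → ℂ} (hx : Measurable x) :
    ∀ᵐ θ ∂(volume.restrict (Set.Icc (-Real.pi) Real.pi)),
      0 ≤ (covForm α (f θ) (x θ) (x θ)).re := by
  have := fun n => h.covForm_re_nonneg_of_bounded hα
    (hx.indicator (measurableSet_boundedSet hx n)) (norm_indicator_boundedSet_le x n)
  filter_upwards [ae_all_iff.2 this] with θ hθ
  obtain ⟨n, hn⟩ := exists_mem_boundedSet x θ
  simpa [hn] using hθ n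

/-- At a fixed `θ` the truncations are eventually equal to `x θ`, so no continuity of `F` is needed.
-/
theorem tendsto_of_indicator_boundedSet {E : Type*} (x : ℝ → Fin T → ℂ) (θ : ℝ)
    {F : (Fin T → ℂ) → E} (l : Filter E) (hl : pure (F (x θ)) ≤ l) :
    Tendsto (fun n => F ((boundedSet x n).indicator x θ)) atTop l := by
  obtain ⟨n, hn⟩ := exists_mem_boundedSet x θ
  refine (tendsto_pure.2 ?_).mono_right hl
  filter_upwards [eventually_ge_atTop n] with m hm
  rw [Set.indicator_of_mem (boundedSet_mono x hm hn)]

theorem monotone_of_indicator_boundedSet (x : ℝ → Fin T → ℂ) (θ : ℝ)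
    {F : (Fin T → ℂ) → ℝ≥0∞} (hF : F 0 = 0) :
    Monotone fun n => F ((boundedSet x n).indicator x θ) := by
  intro m n hmn
  by_cases hθ : θ ∈ boundedSet x m
  · simp [hθ, boundedSet_mono x hmn hθ]
  · simp [hθ, hF]

/-- `L^α` of a spectral density is isometric to a subspace of the `L^α` space of the spectral
measure. -/
theorem IsDensityOf.normPow_eq (hα : 1 < α) (h : IsDensityOf α Γ f)
    {x : ℝ → Fin T → ℂ} (hx : Measurable x) :
    normPow α f x = spectralPow α Γ x := by
  have hxn := fun n => hx.indicator (measurableSet_boundedSet hx n)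
  -- Both sides are limits of the same truncated quantities, by monotone convergence; the common
  -- value may be infinite.
  refine tendsto_nhds_unique (f := fun n : ℕ => normPow α f ((boundedSet x n).indicator x))
    (l := atTop) ?_ ?_
  · refine lintegral_tendsto_of_tendsto_of_monotone
      (fun n => h.aemeasurable_covForm_re (hxn n))
      (Eventually.of_forall fun θ => ?_) (Eventually.of_forall fun θ => ?_)
    · exact monotone_of_indicator_boundedSet x θ
        (F := fun v => ENNReal.ofReal (covForm α (f θ) v v).re) (by simp [covForm])
    · exact tendsto_of_indicator_boundedSet x θ
        (F := fun v => ENNReal.ofReal (covForm α (f θ) v v).re) _ (pure_le_nhds _)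
  · simp only [fun n => h.normPow_eq_of_bounded hα (hxn n) (norm_indicator_boundedSet_le x n)]
    refine lintegral_tendsto_of_tendsto_of_monotone
      (fun n => ((measurable_dotProduct_snd (hxn n)).enorm.pow_const α).aemeasurable)
      (Eventually.of_forall fun p => ?_) (Eventually.of_forall fun p => ?_)
    · exact monotone_of_indicator_boundedSet x p.1
        (F := fun v => ‖v ⬝ᵥ p.2‖ₑ ^ α) (by simp [show 0 < α by linarith])
    · exact tendsto_of_indicator_boundedSet x p.1
        (F := fun v => ‖v ⬝ᵥ p.2‖ₑ ^ α) _ (pure_le_nhds _)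

/-- `ENNReal.ofReal` is additive only on nonnegative reals, hence the appeal to almost everywhere
nonnegativity of each form. -/
theorem IsDensityOf.normPow_add (hα : 1 < α) {Γ' : Measure (ℝ × (Fin T → ℂ))}
    {g : ℝ → Matrix (Fin T) (Fin T) ℂ} (hf : IsDensityOf α Γ f) (hg : IsDensityOf α Γ' g)
    {x : ℝ → Fin T → ℂ} (hx : Measurable x) :
    normPow α (f + g) x = normPow α f x + normPow α g x := by
  rw [normPow, normPow, normPow,
    ← lintegral_add_left' (hf.aemeasurable_covForm_re hx)]
  refine lintegral_congr_ae ?_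
  filter_upwards [hf.covForm_re_nonneg hα hx, hg.covForm_re_nonneg hα hx] with θ h1 h2
  rw [Pi.add_apply, covForm_add, Complex.add_re, ENNReal.ofReal_add h1 h2]

end Density

/-! ### Spectral measures of stable variables -/

section Stable

variable {Ω : Type*} [MeasurableSpace Ω] {α : ℝ} {P : Measure Ω}

/-- The weight `‖u‖^α` offsets radial projection to the circle, so integrals of `α`-homogeneous
functions are preserved when `α > 0`; the origin, sent to `0` by division by zero, then has weight
zero. -/
theorem lintegral_map_normalize (m : Measure ℂ) {F : ℂ → ℝ≥0∞} (hF : Measurable F) :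
    ∫⁻ s, F s ∂((m.withDensity fun u => ‖u‖ₑ ^ α).map fun u : ℂ => u / (‖u‖ : ℂ))
      = ∫⁻ u, ‖u‖ₑ ^ α * F (u / ‖u‖) ∂m := by
  have hn : Measurable fun u : ℂ => u / (‖u‖ : ℂ) := by fun_prop
  rw [lintegral_map hF hn, lintegral_withDensity_eq_lintegral_mul _ (by fun_prop)
    (show Measurable fun u : ℂ => F (u / (‖u‖ : ℂ)) from hF.comp hn)]
  rfl

/-- A symmetric measure with finite `α`-th moment can be moved to the unit circle. -/
theorem exists_isSpectralMeasure (hα : 0 < α) {X : Ω → ℂ} {m : Measure ℂ}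
    (hm : m.map (fun u => -u) = m) (hfin : ∫⁻ u, ‖u‖ₑ ^ α ∂m ≠ ⊤)
    (hchar : ∀ z : ℂ, ∫ ω, Complex.exp (Complex.I * ((z * X ω).re : ℂ)) ∂P
      = Complex.exp (-(((∫⁻ u, ‖(z * u).re‖ₑ ^ α ∂m).toReal : ℝ) : ℂ))) :
    ∃ Γ, IsSpectralMeasure α P X Γ ∧
      ∫⁻ s, ENNReal.ofReal (‖s‖ ^ α) ∂Γ = ∫⁻ u, ‖u‖ₑ ^ α ∂m := by
  have hn : Measurable fun u : ℂ => u / (‖u‖ : ℂ) := by fun_prop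
  have hd : Measurable fun u : ℂ => ‖u‖ₑ ^ α := by fun_prop
  refine ⟨(m.withDensity fun u => ‖u‖ₑ ^ α).map fun u : ℂ => u / (‖u‖ : ℂ),
    ⟨?_, ?_, ?_, fun z => ?_⟩, ?_⟩
  · have := isFiniteMeasure_withDensity hfin
    infer_instance
  · rw [ae_map_iff hn.aemeasurable (measurableSet_eq_fun (by fun_prop) measurable_const),
      ae_withDensity_iff hd]
    refine Eventually.of_forall fun u hu => ?_
    have : u ≠ 0 := by
      rintro rfl
      simp [hα] at hu
    simp [this]
  · refine Measure.ext_of_lintegral _ fun F hF => ?_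
    rw [lintegral_map hF measurable_neg, lintegral_map_normalize m (F := fun s => F (-s))
      (hF.comp measurable_neg),
      lintegral_map_normalize m hF]
    nth_rewrite 1 [← hm]
    rw [lintegral_map (f := fun u => ‖u‖ₑ ^ α * F (-(u / (‖u‖ : ℂ))))
      (hd.mul ((hF.comp measurable_neg).comp hn)) measurable_neg]
    refine lintegral_congr fun u => ?_
    simp [neg_div]
  · rw [hchar, integral_abs_rpow_eq hα.le (by fun_prop),
      lintegral_map_normalize m (F := fun s => ‖(z * s).re‖ₑ ^ α) (by fun_prop)]
    congr 4
    refine lintegral_congr fun u => ?_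
    rcases eq_or_ne u 0 with rfl | hu
    · simp [hα]
    rw [← ENNReal.mul_rpow_of_nonneg _ _ hα.le]
    congr 1
    have h0 : (‖u‖ : ℂ) ≠ 0 := by simpa using hu
    have : z * u = (‖u‖ : ℂ) * (z * (u / ‖u‖)) := by field_simp
    rw [this, Complex.re_ofReal_mul, enorm_mul]
    simp
  · simp only [ofReal_norm_rpow hα.le]
    rw [lintegral_map_normalize m hd]
    refine lintegral_congr fun u => ?_
    rcases eq_or_ne u 0 with rfl | hu
    · simp [hα]
    have : ‖u / (‖u‖ : ℂ)‖ₑ = 1 := by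
      rw [← ofReal_norm]
      simp [hu]
    simp [this]

theorem IsSpectralMeasure.charFun_eq' (hα : 0 ≤ α) {X : Ω → ℂ} {Γ : Measure ℂ}
    (h : IsSpectralMeasure α P X Γ) (z : ℂ) :
    ∫ ω, Complex.exp (Complex.I * ((z * X ω).re : ℂ)) ∂P
      = Complex.exp (-(((∫⁻ s, ‖(z * s).re‖ₑ ^ α ∂Γ).toReal : ℝ) : ℂ)) := by
  rw [h.charFun_eq, integral_abs_rpow_eq hα (by fun_prop)]

theorem IsSpectralMeasure.lintegral_lt_top {X : Ω → ℂ} {Γ : Measure ℂ}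
    (h : IsSpectralMeasure α P X Γ) : ∫⁻ s, ‖s‖ₑ ^ α ∂Γ < ⊤ := by
  have := h.finite
  have h1 : ∫⁻ s, ‖s‖ₑ ^ α ∂Γ = ∫⁻ _s, 1 ∂Γ := by
    refine lintegral_congr_ae ?_
    filter_upwards [h.sphere] with s hs
    rw [← ofReal_norm, hs]
    simp
  rw [h1]
  simp

theorem stableNormPow_zero [IsProbabilityMeasure P] :
    stableNormPow α P (fun _ => 0) = 0 := by
  refine le_antisymm (iInf₂_le_of_le (0 : Measure ℂ) ⟨inferInstance, by simp, by simp, ?_⟩ ?_)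
    zero_le
  · simp
  · simp

/-- Convergence to zero in `‖·‖_α` implies convergence to zero in law. -/
theorem tendsto_charFun_one (hα : 0 < α) {X : ℕ → Ω → ℂ}
    (h : Tendsto (fun m => stableNormPow α P (X m)) atTop (𝓝 0)) (z : ℂ) :
    Tendsto (fun m => ∫ ω, Complex.exp (Complex.I * ((z * X m ω).re : ℂ)) ∂P) atTop (𝓝 1) := by
  have hz : ‖z‖ₑ ^ α ≠ ⊤ := ENNReal.rpow_ne_top_of_nonneg hα.le enorm_ne_top
  rw [Metric.tendsto_nhds]
  intro ε hε
  -- For `z = 0` this threshold is `⊤`, so that case needs no separate treatment.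
  have hpos : 0 < ENNReal.ofReal ε / ‖z‖ₑ ^ α :=
    ENNReal.div_pos (ENNReal.ofReal_pos.2 hε).ne' hz
  filter_upwards [(tendsto_order.1 h).2 _ hpos] with m hm
  simp only [stableNormPow, iInf_lt_iff] at hm
  obtain ⟨Γ, hΓ, hlt⟩ := hm
  simp only [ofReal_norm_rpow hα.le] at hlt
  replace hlt := ENNReal.mul_lt_of_lt_div' hlt
  have hq : (∫⁻ s, ‖(z * s).re‖ₑ ^ α ∂Γ) < ENNReal.ofReal ε :=
    (lintegral_re_mul_le hα.le (fun s => s) z).trans_lt hlt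
  rw [hΓ.charFun_eq' hα.le]
  set q := (∫⁻ s, ‖(z * s).re‖ₑ ^ α ∂Γ).toReal
  have hq0 : 0 ≤ q := ENNReal.toReal_nonneg
  have hqε : q < ε := (ENNReal.lt_ofReal_iff_toReal_lt hq.ne_top).1 hq
  -- The bounds `1 - q ≤ exp (-q) ≤ 1` give `|exp (-q) - 1| ≤ q < ε`.
  have h1 : Real.exp (-q) ≤ 1 := Real.exp_le_one_iff.2 (by linarith)
  have h2 := Real.add_one_le_exp (-q)
  have h3 : Complex.exp (-(q : ℂ)) - 1 = ((Real.exp (-q) - 1 : ℝ) : ℂ) := by push_cast; rfl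
  rw [dist_eq_norm, h3, Complex.norm_real, Real.norm_eq_abs, abs_lt]
  constructor <;> linarith

/-- This is nonnegativity of the variance of `‖w‖`. -/
theorem sq_integral_norm_le [IsProbabilityMeasure P] {w : Ω → ℂ} (hw : AEStronglyMeasurable w P)
    {C : ℝ} (hC : ∀ ω, ‖w ω‖ ≤ C) : (∫ ω, ‖w ω‖ ∂P) ^ 2 ≤ ∫ ω, ‖w ω‖ ^ 2 ∂P := by
  have hm : MemLp (fun ω => ‖w ω‖) 2 P :=
    (MemLp.of_bound hw C (Eventually.of_forall hC)).norm
  have h1 := variance_nonneg (fun ω => ‖w ω‖) P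
  rw [variance_eq_sub hm] at h1
  simp only [Pi.pow_apply] at h1
  linarith

/-- Perturbing by variables converging to zero in law does not change the limit law. -/
theorem tendsto_charFun_sub [IsProbabilityMeasure P] {s t : ℕ → Ω → ℝ}
    (hs : ∀ m, Measurable (s m)) (ht : ∀ m, Measurable (t m))
    (h : Tendsto (fun m => ∫ ω, Complex.exp (Complex.I * (t m ω : ℂ)) ∂P) atTop (𝓝 1)) :
    Tendsto (fun m => ∫ ω, Complex.exp (Complex.I * ((s m ω + t m ω : ℝ) : ℂ)) ∂P
      - ∫ ω, Complex.exp (Complex.I * (s m ω : ℂ)) ∂P) atTop (𝓝 0) := by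
  have hnorm : ∀ r : ℝ, ‖Complex.exp (Complex.I * (r : ℂ))‖ = 1 := fun r => by
    rw [mul_comm]; exact Complex.norm_exp_ofReal_mul_I r
  have hmeas : ∀ r : Ω → ℝ, Measurable r →
      AEStronglyMeasurable (fun ω => Complex.exp (Complex.I * (r ω : ℂ))) P := fun r hr =>
    (Complex.measurable_exp.comp
      ((Complex.measurable_ofReal.comp hr).const_mul _)).aestronglyMeasurable
  have hint : ∀ r : Ω → ℝ, Measurable r →
      Integrable (fun ω => Complex.exp (Complex.I * (r ω : ℂ))) P := fun r hr =>
    Integrable.of_bound (hmeas r hr) 1 (Eventually.of_forall fun ω => (hnorm _).le)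
  let w : ℕ → Ω → ℂ := fun m ω => Complex.exp (Complex.I * (t m ω : ℂ)) - 1
  have hwm : ∀ m, AEStronglyMeasurable (w m) P := fun m =>
    (hmeas _ (ht m)).sub aestronglyMeasurable_const
  have hw2 : ∀ m ω, ‖w m ω‖ ≤ 2 := fun m ω =>
    (norm_sub_le _ _).trans (by rw [hnorm]; norm_num)
  -- Since `|e^{it} - 1|² = 2 - 2 Re e^{it}`, the mean square of `w` is controlled by the
  -- characteristic function alone.
  have hwsq : ∀ m, ∫ ω, ‖w m ω‖ ^ 2 ∂P
      = 2 - 2 * (∫ ω, Complex.exp (Complex.I * (t m ω : ℂ)) ∂P).re := fun m => by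
    have h1 : ∀ ω, ‖w m ω‖ ^ 2 = 2 - 2 * (Complex.exp (Complex.I * (t m ω : ℂ))).re := fun ω => by
      have := hnorm (t m ω)
      rw [← Complex.normSq_eq_norm_sq, Complex.normSq_sub, Complex.normSq_eq_norm_sq, this]
      simp
      ring
    simp only [h1]
    have hre : Integrable (fun ω => (Complex.exp (Complex.I * (t m ω : ℂ))).re) P :=
      (hint _ (ht m)).re
    rw [integral_sub (integrable_const _) (hre.const_mul 2), integral_const_mul]
    have : ∫ ω, (Complex.exp (Complex.I * (t m ω : ℂ))).re ∂P
        = (∫ ω, Complex.exp (Complex.I * (t m ω : ℂ)) ∂P).re := integral_re (hint _ (ht m))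
    rw [this]
    simp
  have hlim : Tendsto (fun m => √(2 - 2 * (∫ ω, Complex.exp (Complex.I * (t m ω : ℂ)) ∂P).re))
      atTop (𝓝 0) := by
    have h1 := (((Complex.continuous_re.tendsto _).comp h).const_mul 2).const_sub 2
    have h2 := (Real.continuous_sqrt.tendsto _).comp h1
    simpa [Function.comp_def] using h2
  refine squeeze_zero_norm (fun m => ?_) hlim
  refine le_trans ?_ (Real.le_sqrt_of_sq_le ((sq_integral_norm_le (hwm m) (hw2 m)).trans_eq
    (hwsq m)))
  rw [← integral_sub (hint (fun ω => s m ω + t m ω) ((hs m).add (ht m))) (hint _ (hs m))]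
  refine (norm_integral_le_integral_norm _).trans_eq (integral_congr_ae (Eventually.of_forall
    fun ω => ?_))
  change ‖_‖ = ‖w m ω‖
  have : Complex.exp (Complex.I * ((s m ω + t m ω : ℝ) : ℂ)) - Complex.exp (Complex.I * (s m ω : ℂ))
      = Complex.exp (Complex.I * (s m ω : ℂ)) * w m ω := by
    simp only [w]
    push_cast
    rw [mul_add, Complex.exp_add]
    ring
  rw [this, norm_mul, hnorm, one_mul]

end Stable

/-! ### Polynomials and linear combinations -/

section Polynomials

variable {T : ℕ}

theorem linComb_eq_sum {Ω : Type*} (c : ℤ →₀ (Fin T → ℂ)) (ζ : ℤ → Ω → Fin T → ℂ) (ω : Ω) :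
    linComb c ζ ω = c.sum fun j v => v ⬝ᵥ ζ j ω := rfl

theorem trigPoly_eq_sum (c : ℤ →₀ (Fin T → ℂ)) (θ : ℝ) :
    trigPoly c θ = c.sum fun j v => Complex.exp (Complex.I * ((j * θ : ℝ) : ℂ)) • v := rfl

theorem linComb_add {Ω : Type*} (c d : ℤ →₀ (Fin T → ℂ)) (ζ : ℤ → Ω → Fin T → ℂ) (ω : Ω) :
    linComb (c + d) ζ ω = linComb c ζ ω + linComb d ζ ω := by
  simp only [linComb_eq_sum]
  exact Finsupp.sum_add_index' (fun _ => zero_dotProduct _) fun _ _ _ => add_dotProduct _ _ _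

theorem trigPoly_add (c d : ℤ →₀ (Fin T → ℂ)) (θ : ℝ) :
    trigPoly (c + d) θ = trigPoly c θ + trigPoly d θ := by
  simp only [trigPoly_eq_sum]
  exact Finsupp.sum_add_index' (fun _ => smul_zero _) fun _ _ _ => smul_add _ _ _

theorem linComb_smul {Ω : Type*} (z : ℂ) (c : ℤ →₀ (Fin T → ℂ)) (ζ : ℤ → Ω → Fin T → ℂ) (ω : Ω) :
    linComb (z • c) ζ ω = z * linComb c ζ ω := by
  simp only [linComb_eq_sum]
  rw [Finsupp.sum_smul_index' (h := fun j v => v ⬝ᵥ ζ j ω) fun _ => zero_dotProduct _, Finsupp.mul_sum]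
  simp [smul_dotProduct]

theorem trigPoly_smul (z : ℂ) (c : ℤ →₀ (Fin T → ℂ)) (θ : ℝ) :
    trigPoly (z • c) θ = z • trigPoly c θ := by
  simp only [trigPoly_eq_sum]
  rw [Finsupp.sum_smul_index' fun _ => smul_zero _, Finsupp.smul_sum]
  exact Finsupp.sum_congr fun j _ => smul_comm _ _ _

theorem linComb_add_right {Ω : Type*} (c : ℤ →₀ (Fin T → ℂ)) (ξ η : ℤ → Ω → Fin T → ℂ) (ω : Ω) :
    linComb c (ξ + η) ω = linComb c ξ ω + linComb c η ω := by
  simp [linComb, dotProduct_add, Finset.sum_add_distrib]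

/-- The coefficients of the polynomial `A_N`. -/
noncomputable def symbolCoeff (N : ℕ) (a : ℕ → Fin T → ℂ) : ℤ →₀ (Fin T → ℂ) :=
  ∑ j ∈ Finset.range (N + 1), Finsupp.single (j : ℤ) (a j)

theorem linComb_symbolCoeff {Ω : Type*} (N : ℕ) (a : ℕ → Fin T → ℂ) (ξ : ℤ → Ω → Fin T → ℂ)
    (ω : Ω) : linComb (symbolCoeff N a) ξ ω = functionalA N a ξ ω := by
  rw [linComb_eq_sum, symbolCoeff, ← Finsupp.sum_finsetSum_index
    (h := fun j v => v ⬝ᵥ ξ j ω) (fun _ => zero_dotProduct _) fun _ _ _ => add_dotProduct _ _ _]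
  simp [functionalA]

theorem functionalA_sub_linComb {Ω : Type*} (N : ℕ) (a : ℕ → Fin T → ℂ) (ξ η : ℤ → Ω → Fin T → ℂ)
    (c : ℤ →₀ (Fin T → ℂ)) (ω : Ω) :
    functionalA N a ξ ω - linComb c (ξ + η) ω
      = linComb (symbolCoeff N a + (-1 : ℂ) • c) ξ ω + linComb ((-1 : ℂ) • c) η ω := by
  rw [linComb_add, linComb_smul, linComb_smul, linComb_symbolCoeff, linComb_add_right]
  ring

theorem trigPoly_symbolCoeff (N : ℕ) (a : ℕ → Fin T → ℂ) (θ : ℝ) :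
    trigPoly (symbolCoeff N a) θ = symbolA N a θ := by
  rw [trigPoly_eq_sum, symbolCoeff, ← Finsupp.sum_finsetSum_index (fun _ => smul_zero _)
    fun _ _ _ => smul_add _ _ _]
  simp [symbolA]

theorem measurable_trigPoly (c : ℤ →₀ (Fin T → ℂ)) : Measurable (trigPoly c) := by
  unfold trigPoly
  fun_prop

theorem norm_trigPoly_le (c : ℤ →₀ (Fin T → ℂ)) (θ : ℝ) (k : Fin T) :
    ‖trigPoly c θ k‖ ≤ ∑ j ∈ c.support, ‖c j‖ := by
  refine (norm_le_pi_norm _ k).trans ((norm_sum_le _ _).trans (Finset.sum_le_sum fun j _ => ?_))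
  rw [norm_smul, mul_comm Complex.I, Complex.norm_exp_ofReal_mul_I, one_mul]

theorem measurable_linComb {Ω : Type*} [MeasurableSpace Ω] (c : ℤ →₀ (Fin T → ℂ))
    {ζ : ℤ → Ω → Fin T → ℂ} (hζ : ∀ n, Measurable (ζ n)) : Measurable (linComb c ζ) := by
  unfold linComb
  simp only [dotProduct]
  exact Finset.measurable_fun_sum _ fun j _ => Finset.measurable_fun_sum _ fun k _ =>
    ((measurable_pi_apply k).comp (hζ j)).const_mul _

end Polynomials

/-! ### Continuity of the error -/

section Error

variable {T : ℕ} {α : ℝ} {Γ Γ' : Measure (ℝ × (Fin T → ℂ))} {f g : ℝ → Matrix (Fin T) (Fin T) ℂ}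

/-- `∫ |Re(z x(θ)ᵀ s)|^α dΓ(θ, s)`. -/
noncomputable def spectralRePow (α : ℝ) (Γ : Measure (ℝ × (Fin T → ℂ))) (x : ℝ → Fin T → ℂ)
    (z : ℂ) : ℝ≥0∞ :=
  ∫⁻ p, ‖(z * (x p.1 ⬝ᵥ p.2)).re‖ₑ ^ α ∂Γ

theorem spectralRePow_neg (x : ℝ → Fin T → ℂ) (z : ℂ) :
    spectralRePow α Γ (-x) z = spectralRePow α Γ x z := by
  simp only [spectralRePow, Pi.neg_apply, neg_dotProduct, mul_neg, Complex.neg_re, enorm_neg]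

theorem spectralRePow_le (hα : 0 ≤ α) (x : ℝ → Fin T → ℂ) (z : ℂ) :
    spectralRePow α Γ x z ≤ ‖z‖ₑ ^ α * spectralPow α Γ x :=
  lintegral_re_mul_le hα _ z

theorem spectralRePow_lt_top (hα : 0 ≤ α) {x : ℝ → Fin T → ℂ} (h : spectralPow α Γ x < ⊤) (z : ℂ) :
    spectralRePow α Γ x z < ⊤ :=
  (spectralRePow_le hα x z).trans_lt
    (ENNReal.mul_lt_top (ENNReal.rpow_ne_top_of_nonneg hα enorm_ne_top).lt_top h)

theorem tendsto_spectralPow (hα : 1 ≤ α) {v : ℕ → ℝ → Fin T → ℂ} {w : ℝ → Fin T → ℂ}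
    (hv : ∀ m, Measurable (v m)) (hw : Measurable w)
    (h : Tendsto (fun m => spectralPow α Γ (v m - w)) atTop (𝓝 0)) :
    Tendsto (fun m => spectralPow α Γ (v m)) atTop (𝓝 (spectralPow α Γ w)) := by
  refine tendsto_lintegral_rpow_enorm hα
    (fun m => (measurable_dotProduct_snd (hv m)).aestronglyMeasurable)
    (measurable_dotProduct_snd hw).aestronglyMeasurable ?_
  simpa only [spectralPow, Pi.sub_apply, sub_dotProduct] using h

theorem tendsto_spectralRePow (hα : 1 ≤ α) {v : ℕ → ℝ → Fin T → ℂ} {w : ℝ → Fin T → ℂ}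
    (hv : ∀ m, Measurable (v m)) (hw : Measurable w)
    (h : Tendsto (fun m => spectralPow α Γ (v m - w)) atTop (𝓝 0)) (z : ℂ) :
    Tendsto (fun m => spectralRePow α Γ (v m) z) atTop (𝓝 (spectralRePow α Γ w z)) := by
  refine tendsto_lintegral_re_mul hα (fun m => measurable_dotProduct_snd (hv m))
    (measurable_dotProduct_snd hw) ?_ z
  simpa only [spectralPow, Pi.sub_apply, sub_dotProduct] using h

theorem spectralPow_neg (x : ℝ → Fin T → ℂ) : spectralPow α Γ (-x) = spectralPow α Γ x := by
  simp only [spectralPow, Pi.neg_apply, neg_dotProduct, enorm_neg]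

/-- Convergence in `L^α` at finite distance from a bounded function forces a finite norm. -/
theorem spectralPow_lt_top_of_tendsto (hα : 1 ≤ α) {v : ℕ → ℝ → Fin T → ℂ} {w : ℝ → Fin T → ℂ}
    (hv : ∀ m, Measurable (v m)) (hw : Measurable w) (hfin : ∀ m, spectralPow α Γ (v m) < ⊤)
    (h : Tendsto (fun m => spectralPow α Γ (v m - w)) atTop (𝓝 0)) :
    spectralPow α Γ w < ⊤ := by
  have hα0 : 0 < α := by linarith
  -- One index at finite distance is enough: `w = v m - (v m - w)` is a difference of two `L^α`
  -- functions.
  obtain ⟨m, hm⟩ := ((tendsto_order.1 h).2 ⊤ ENNReal.zero_lt_top).exists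
  have key : ∀ x : ℝ → Fin T → ℂ, Measurable x → (spectralPow α Γ x < ⊤ ↔
      MemLp (fun p : ℝ × (Fin T → ℂ) => x p.1 ⬝ᵥ p.2) (ENNReal.ofReal α) Γ) := fun x hx => by
    have h0 : ENNReal.ofReal α ≠ 0 := by simpa using hα0
    rw [MemLp, and_iff_right (measurable_dotProduct_snd hx).aestronglyMeasurable,
      eLpNorm_lt_top_iff_lintegral_rpow_enorm_lt_top h0 ENNReal.ofReal_ne_top,
      ENNReal.toReal_ofReal hα0.le]
    rfl
  rw [key _ hw]
  have h1 := ((key _ (hv m)).1 (hfin m)).sub ((key _ ((hv m).sub hw)).1 hm)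
  refine h1.ae_eq (Eventually.of_forall fun p => ?_)
  simp [sub_dotProduct]

/-- The norm for `f + g` splits as a sum of nonnegative terms, so it dominates each of them. -/
theorem tendsto_spectralPow_of_normPow_add (hα : 1 < α) (hf : IsDensityOf α Γ f)
    (hg : IsDensityOf α Γ' g) {v : ℕ → ℝ → Fin T → ℂ} {w : ℝ → Fin T → ℂ}
    (hv : ∀ m, Measurable (v m)) (hw : Measurable w)
    (h : Tendsto (fun m => normPow α (f + g) (fun θ => v m θ - w θ)) atTop (𝓝 0)) :
    Tendsto (fun m => spectralPow α Γ (v m - w)) atTop (𝓝 0) ∧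
      Tendsto (fun m => spectralPow α Γ' (v m - w)) atTop (𝓝 0) := by
  have h1 : ∀ m, normPow α (f + g) (fun θ => v m θ - w θ)
      = spectralPow α Γ (v m - w) + spectralPow α Γ' (v m - w) := fun m => by
    change normPow α (f + g) (v m - w) = _
    rw [hf.normPow_add hα hg ((hv m).sub hw), hf.normPow_eq hα ((hv m).sub hw),
      hg.normPow_eq hα ((hv m).sub hw)]
  simp only [h1] at h
  exact ⟨tendsto_of_tendsto_of_tendsto_of_le_of_le tendsto_const_nhds h (fun _ => zero_le)
      fun _ => le_self_add,
    tendsto_of_tendsto_of_tendsto_of_le_of_le tendsto_const_nhds h (fun _ => zero_le)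
      fun _ => le_add_self⟩

theorem measurable_symbolA (N : ℕ) (a : ℕ → Fin T → ℂ) : Measurable (symbolA N a) := by
  rw [← funext (trigPoly_symbolCoeff N a)]
  exact measurable_trigPoly _

theorem estError_eq (hα : 1 < α) (hf : IsDensityOf α Γ f) (hg : IsDensityOf α Γ' g) (N : ℕ)
    (a : ℕ → Fin T → ℂ) {h : ℝ → Fin T → ℂ} (hh : Measurable h) :
    estError α N a h f g = spectralPow α Γ (symbolA N a - h) + spectralPow α Γ' h := by
  have := hf.normPow_eq hα ((measurable_symbolA N a).sub hh)
  rw [estError, hg.normPow_eq hα hh, ← this]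
  rfl

theorem tendsto_symbolA_sub {N : ℕ} {a : ℕ → Fin T → ℂ} {v : ℕ → ℝ → Fin T → ℂ}
    {w : ℝ → Fin T → ℂ} (h : Tendsto (fun m => spectralPow α Γ (v m - w)) atTop (𝓝 0)) :
    Tendsto (fun m => spectralPow α Γ ((symbolA N a - v m) - (symbolA N a - w))) atTop (𝓝 0) := by
  have : ∀ m, (symbolA N a - v m) - (symbolA N a - w) = -(v m - w) := fun m => by abel
  simpa only [this, spectralPow_neg] using h

theorem tendsto_estError (hα : 1 < α) (hf : IsDensityOf α Γ f) (hg : IsDensityOf α Γ' g) (N : ℕ)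
    (a : ℕ → Fin T → ℂ) {v : ℕ → ℝ → Fin T → ℂ} {w : ℝ → Fin T → ℂ}
    (hv : ∀ m, Measurable (v m)) (hw : Measurable w)
    (h : Tendsto (fun m => normPow α (f + g) (fun θ => v m θ - w θ)) atTop (𝓝 0)) :
    Tendsto (fun m => estError α N a (v m) f g) atTop (𝓝 (estError α N a w f g)) := by
  obtain ⟨h1, h2⟩ := tendsto_spectralPow_of_normPow_add hα hf hg hv hw h
  have hA := measurable_symbolA N a
  simp only [estError_eq hα hf hg N a hw, fun m => estError_eq hα hf hg N a (hv m)]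
  exact (tendsto_spectralPow hα.le (fun m => hA.sub (hv m)) (hA.sub hw)
    (tendsto_symbolA_sub h1)).add (tendsto_spectralPow hα.le hv hw h2)

end Error

/-! ### Estimation errors of random variables -/

section Estimates

variable {Ω : Type*} [MeasurableSpace Ω] {T : ℕ} {α : ℝ} {P : Measure Ω}
  {Γ Γ' : Measure (ℝ × (Fin T → ℂ))} {f g : ℝ → Matrix (Fin T) (Fin T) ℂ}

theorem IsDensityOf.map_dotProduct_symm (hf : IsDensityOf α Γ f) {x : ℝ → Fin T → ℂ}
    (hx : Measurable x) :
    (Γ.map fun p => x p.1 ⬝ᵥ p.2).map (fun u => -u) = Γ.map fun p => x p.1 ⬝ᵥ p.2 := by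
  have hm := measurable_dotProduct_snd hx
  have hneg : Measurable fun p : ℝ × (Fin T → ℂ) => (p.1, -p.2) := by fun_prop
  conv_rhs => rw [← hf.symm]
  rw [Measure.map_map measurable_neg hm, Measure.map_map hm hneg]
  congr 1
  ext p
  simp

/-- A variable with characteristic exponent `∫ |Re(z xᵀ s)|^α dΓ + ∫ |Re(z yᵀ s)|^α dΓ'` has
covariation norm at most that of `(x, y)`. -/
theorem stableNormPow_le (hα : 0 < α) (hf : IsDensityOf α Γ f) (hg : IsDensityOf α Γ' g)
    {x y : ℝ → Fin T → ℂ} (hx : Measurable x) (hy : Measurable y)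
    (hxfin : spectralPow α Γ x < ⊤) (hyfin : spectralPow α Γ' y < ⊤) {X : Ω → ℂ}
    (hchar : ∀ z : ℂ, ∫ ω, Complex.exp (Complex.I * ((z * X ω).re : ℂ)) ∂P
      = Complex.exp (-(((spectralRePow α Γ x z + spectralRePow α Γ' y z).toReal : ℝ) : ℂ))) :
    stableNormPow α P X ≤ spectralPow α Γ x + spectralPow α Γ' y := by
  have hxm := measurable_dotProduct_snd hx
  have hym := measurable_dotProduct_snd hy
  -- The exponent of `X` is an integral against this measure on `ℂ`; only the projection to the unit
  -- circle is still missing.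
  let m : Measure ℂ := (Γ.map fun p => x p.1 ⬝ᵥ p.2) + Γ'.map fun p => y p.1 ⬝ᵥ p.2
  have hm : ∀ F : ℂ → ℝ≥0∞, Measurable F →
      ∫⁻ u, F u ∂m = ∫⁻ p, F (x p.1 ⬝ᵥ p.2) ∂Γ + ∫⁻ p, F (y p.1 ⬝ᵥ p.2) ∂Γ' := fun F hF => by
    rw [lintegral_add_measure, lintegral_map hF hxm, lintegral_map hF hym]
  have hnorm : ∫⁻ u, ‖u‖ₑ ^ α ∂m = spectralPow α Γ x + spectralPow α Γ' y := hm _ (by fun_prop)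
  obtain ⟨G, hG, hGeq⟩ := exists_isSpectralMeasure (P := P) (X := X) (m := m) hα
    (by rw [Measure.map_add _ _ measurable_neg, hf.map_dotProduct_symm hx,
      hg.map_dotProduct_symm hy])
    (hnorm ▸ (ENNReal.add_lt_top.2 ⟨hxfin, hyfin⟩).ne) fun z => by
      rw [hchar, hm (fun u => ‖(z * u).re‖ₑ ^ α) (by fun_prop)]
      rfl
  exact (iInf₂_le G hG).trans_eq (hGeq.trans hnorm)

/-- The characteristic exponent determines the covariation norm. -/
theorem le_stableNormPow (hα : 0 < α) (hf : IsDensityOf α Γ f) (hg : IsDensityOf α Γ' g)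
    {x y : ℝ → Fin T → ℂ} (hx : Measurable x) (hy : Measurable y)
    (hxfin : spectralPow α Γ x < ⊤) (hyfin : spectralPow α Γ' y < ⊤) {X : Ω → ℂ}
    (hchar : ∀ z : ℂ, ∫ ω, Complex.exp (Complex.I * ((z * X ω).re : ℂ)) ∂P
      = Complex.exp (-(((spectralRePow α Γ x z + spectralRePow α Γ' y z).toReal : ℝ) : ℂ))) :
    spectralPow α Γ x + spectralPow α Γ' y ≤ stableNormPow α P X := by
  have := hf.finite
  have := hg.finite
  -- The bound is proved for every spectral measure `G` of `X`; if there is none, the infimum is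
  -- `⊤`.
  refine le_iInf₂ fun G hG => ?_
  have := hG.finite
  have hxm := measurable_dotProduct_snd hx
  have hym := measurable_dotProduct_snd hy
  have hexp : ∀ z : ℂ, spectralRePow α Γ x z + spectralRePow α Γ' y z
      = ∫⁻ s, ‖(z * s).re‖ₑ ^ α ∂G := fun z => by
    have h1 : (∫⁻ s, ‖(z * s).re‖ₑ ^ α ∂G) < ⊤ :=
      (lintegral_re_mul_le hα.le (fun s => s) z).trans_lt
        (ENNReal.mul_lt_top (ENNReal.rpow_ne_top_of_nonneg hα.le enorm_ne_top).lt_top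
          hG.lintegral_lt_top)
    have h2 : spectralRePow α Γ x z + spectralRePow α Γ' y z < ⊤ :=
      ENNReal.add_lt_top.2 ⟨spectralRePow_lt_top hα.le hxfin z, spectralRePow_lt_top hα.le hyfin z⟩
    have h3 := (hchar z).symm.trans (hG.charFun_eq' hα.le z)
    rw [← Complex.ofReal_neg, ← Complex.ofReal_neg, ← Complex.ofReal_exp, ← Complex.ofReal_exp,
      Complex.ofReal_inj, Real.exp_eq_exp, neg_inj] at h3
    exact (ENNReal.toReal_eq_toReal_iff' h2.ne h1.ne).1 h3
  simp only [ofReal_norm_rpow hα.le]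
  -- Integrating `hexp` over the unit disc turns both exponents into `α`-th moments times `discConst
  -- α`, which cancels.
  refine le_of_eq ((ENNReal.mul_left_inj (discConst_ne_zero hα) (discConst_ne_top hα.le)).1 ?_)
  have hG' := lintegral_disc_lintegral (μ := G) hα (u := fun s => s) measurable_id
  rw [← hG', add_mul]
  simp only [← hexp]
  rw [lintegral_add_left]
  · exact (congrArg₂ _ (lintegral_disc_lintegral hα hxm) (lintegral_disc_lintegral hα hym)).symm
  · exact Measurable.lintegral_prod_right'
      (f := fun q : ℂ × (ℝ × (Fin T → ℂ)) => ‖(q.1 * (x q.2.1 ⬝ᵥ q.2.2)).re‖ₑ ^ α) (by fun_prop)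

/-- The factor `z` is absorbed into the coefficients. -/
theorem charFun_linComb (hα : 0 ≤ α) {ξ : ℤ → Ω → Fin T → ℂ}
    (hchar : ∀ c : ℤ →₀ (Fin T → ℂ),
      ∫ ω, Complex.exp (Complex.I * ((linComb c ξ ω).re : ℂ)) ∂P
        = Complex.exp (-((∫ p, |(trigPoly c p.1 ⬝ᵥ p.2).re| ^ α ∂Γ : ℝ) : ℂ)))
    (c : ℤ →₀ (Fin T → ℂ)) (z : ℂ) :
    ∫ ω, Complex.exp (Complex.I * ((z * linComb c ξ ω).re : ℂ)) ∂P
      = Complex.exp (-(((spectralRePow α Γ (trigPoly c) z).toReal : ℝ) : ℂ)) := by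
  have h := hchar (z • c)
  have hm : Measurable fun p : ℝ × (Fin T → ℂ) => (trigPoly (z • c) p.1 ⬝ᵥ p.2).re :=
    Complex.measurable_re.comp (measurable_dotProduct_snd (measurable_trigPoly _))
  rw [integral_abs_rpow_eq hα hm] at h
  simpa only [spectralRePow, linComb_smul, trigPoly_smul, smul_dotProduct, smul_eq_mul] using h

theorem measurable_exp_linComb {ζ : ℤ → Ω → Fin T → ℂ} (hζ : ∀ n, Measurable (ζ n))
    (c : ℤ →₀ (Fin T → ℂ)) (z : ℂ) :
    Measurable fun ω => Complex.exp (Complex.I * ((z * linComb c ζ ω).re : ℂ)) :=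
  Complex.measurable_exp.comp ((Complex.measurable_ofReal.comp
    (Complex.measurable_re.comp ((measurable_linComb c hζ).const_mul z))).const_mul _)

theorem charFun_add_of_indep {ξ η : ℤ → Ω → Fin T → ℂ} (hξ : ∀ n, Measurable (ξ n))
    (hη : ∀ n, Measurable (η n))
    (hindep : IndepFun (fun ω n => ξ n ω) (fun ω n => η n ω) P) (c d : ℤ →₀ (Fin T → ℂ)) (z : ℂ) :
    ∫ ω, Complex.exp (Complex.I * ((z * (linComb c ξ ω + linComb d η ω)).re : ℂ)) ∂P
      = (∫ ω, Complex.exp (Complex.I * ((z * linComb c ξ ω).re : ℂ)) ∂P)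
        * ∫ ω, Complex.exp (Complex.I * ((z * linComb d η ω).re : ℂ)) ∂P := by
  have hcoord : ∀ n : ℤ, Measurable fun w : ℤ → Fin T → ℂ => w n := fun n => measurable_pi_apply n
  have hi := hindep.comp (measurable_exp_linComb hcoord c z) (measurable_exp_linComb hcoord d z)
  have h := hi.integral_fun_mul_eq_mul_integral (measurable_exp_linComb hξ c z).aestronglyMeasurable
    (measurable_exp_linComb hη d z).aestronglyMeasurable
  refine Eq.trans (integral_congr_ae (Eventually.of_forall fun ω => ?_)) h
  change _ = Complex.exp (Complex.I * ((z * linComb c ξ ω).re : ℂ))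
    * Complex.exp (Complex.I * ((z * linComb d η ω).re : ℂ))
  beta_reduce
  rw [← Complex.exp_add, ← mul_add, mul_add z, Complex.add_re, Complex.ofReal_add]

theorem charFun_functionalA_sub_linComb (hα : 0 ≤ α) (hf : IsDensityOf α Γ f)
    (hg : IsDensityOf α Γ' g) {ξ η : ℤ → Ω → Fin T → ℂ} (hξ : ∀ n, Measurable (ξ n))
    (hη : ∀ n, Measurable (η n))
    (hξchar : ∀ c : ℤ →₀ (Fin T → ℂ),
      ∫ ω, Complex.exp (Complex.I * ((linComb c ξ ω).re : ℂ)) ∂P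
        = Complex.exp (-((∫ p, |(trigPoly c p.1 ⬝ᵥ p.2).re| ^ α ∂Γ : ℝ) : ℂ)))
    (hηchar : ∀ c : ℤ →₀ (Fin T → ℂ),
      ∫ ω, Complex.exp (Complex.I * ((linComb c η ω).re : ℂ)) ∂P
        = Complex.exp (-((∫ p, |(trigPoly c p.1 ⬝ᵥ p.2).re| ^ α ∂Γ' : ℝ) : ℂ)))
    (hindep : IndepFun (fun ω n => ξ n ω) (fun ω n => η n ω) P)
    (N : ℕ) (a : ℕ → Fin T → ℂ) (c : ℤ →₀ (Fin T → ℂ)) (z : ℂ) :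
    ∫ ω, Complex.exp
        (Complex.I * ((z * (functionalA N a ξ ω - linComb c (ξ + η) ω)).re : ℂ)) ∂P
      = Complex.exp (-(((spectralRePow α Γ (symbolA N a - trigPoly c) z
          + spectralRePow α Γ' (trigPoly c) z).toReal : ℝ) : ℂ)) := by
  have hx : trigPoly (symbolCoeff N a + (-1 : ℂ) • c) = symbolA N a - trigPoly c := by
    funext θ
    rw [trigPoly_add, trigPoly_smul, trigPoly_symbolCoeff, neg_one_smul, ← sub_eq_add_neg]
    rfl
  have hy : trigPoly ((-1 : ℂ) • c) = -trigPoly c := by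
    funext θ
    rw [trigPoly_smul, neg_one_smul]
    rfl
  -- Finiteness is what allows `toReal` to split over the sum of the two exponents.
  have hfin1 := spectralRePow_lt_top hα
    (hf.spectralPow_lt_top hα (norm_trigPoly_le (symbolCoeff N a + (-1 : ℂ) • c))) z
  have hfin2 := spectralRePow_lt_top hα (hg.spectralPow_lt_top hα (norm_trigPoly_le c)) z
  simp only [functionalA_sub_linComb]
  rw [charFun_add_of_indep hξ hη hindep, charFun_linComb hα hξchar, charFun_linComb hα hηchar,
    ← Complex.exp_add, hy, spectralRePow_neg, ← hx,
    ENNReal.toReal_add hfin1.ne hfin2.ne]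
  push_cast
  ring_nf

theorem measurable_functionalA (N : ℕ) (a : ℕ → Fin T → ℂ) {ξ : ℤ → Ω → Fin T → ℂ}
    (hξ : ∀ n, Measurable (ξ n)) : Measurable (functionalA N a ξ) := by
  rw [← funext (linComb_symbolCoeff N a ξ)]
  exact measurable_linComb _ hξ

/-- The spectral characteristic of the optimal estimate minimizes `Δ(h; f, g)`. -/
theorem IsOptimalCharacteristic.estError_le [IsProbabilityMeasure P] (hα : 1 < α)
    {N : ℕ} {a : ℕ → Fin T → ℂ} {ξ η : ℤ → Ω → Fin T → ℂ}
    (hξ : IsHarmonizable α P ξ f) (hη : IsHarmonizable α P η g)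
    (hindep : IndepFun (fun ω n => ξ n ω) (fun ω n => η n ω) P) {h₀ : ℝ → Fin T → ℂ}
    (hh₀ : IsOptimalCharacteristic α P N a ξ η f g h₀) {h : ℝ → Fin T → ℂ}
    (hh : h ∈ estimateSpace α N (f + g)) :
    estError α N a h₀ f g ≤ estError α N a h f g := by
  obtain ⟨hξm, Γ, hf, hξchar⟩ := hξ
  obtain ⟨hηm, Γ', hg, hηchar⟩ := hη
  obtain ⟨Y, ⟨⟨hYm, -⟩, hYopt⟩, hh₀m, c, -, hcY, hch⟩ := hh₀
  obtain ⟨hhm, d, hdgap, hd⟩ := hh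
  have hα0 : 0 < α := by linarith
  have hpoly := fun e : ℤ →₀ (Fin T → ℂ) => measurable_trigPoly e
  have hsymb := measurable_symbolA N a
  have hζm : ∀ n, Measurable ((ξ + η) n) := fun n => (hξm n).add (hηm n)
  have hchar := fun (e : ℤ →₀ (Fin T → ℂ)) (z : ℂ) =>
    charFun_functionalA_sub_linComb hα0.le hf hg hξm hηm hξchar hηchar hindep N a e z
  have hfin : ∀ e : ℤ →₀ (Fin T → ℂ), spectralPow α Γ (symbolA N a - trigPoly e) < ⊤ ∧
      spectralPow α Γ' (trigPoly e) < ⊤ := fun e => by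
    refine ⟨hf.spectralPow_lt_top hα0.le (fun θ k => ?_ : ∀ θ k, _ ≤
      ∑ j ∈ (symbolCoeff N a).support, ‖symbolCoeff N a j‖ + ∑ j ∈ e.support, ‖e j‖),
      hg.spectralPow_lt_top hα0.le (norm_trigPoly_le e)⟩
    refine (norm_sub_le (symbolA N a θ k) (trigPoly e θ k)).trans
      (add_le_add ?_ (norm_trigPoly_le e θ k))
    rw [← trigPoly_symbolCoeff]
    exact norm_trigPoly_le _ θ k
  -- A polynomial estimate is an admissible competitor, being the limit of its own constant
  -- sequence.
  have hupper : ∀ m, stableNormPow α P (fun ω => functionalA N a ξ ω - Y ω)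
      ≤ estError α N a (trigPoly (d m)) f g := fun m => by
    refine (hYopt (linComb (d m) (ξ + η)) ⟨measurable_linComb _ hζm, fun _ => d m,
      fun _ => hdgap m, ?_⟩).trans ?_
    · simp only [sub_self, stableNormPow_zero]
      exact tendsto_const_nhds
    · rw [estError_eq hα hf hg N a (hpoly _)]
      exact stableNormPow_le hα0 hf hg (hsymb.sub (hpoly _)) (hpoly _) (hfin _).1 (hfin _).2
        (hchar (d m))
  have hlower : estError α N a h₀ f g
      ≤ stableNormPow α P (fun ω => functionalA N a ξ ω - Y ω) := by
    obtain ⟨h1, h2⟩ := tendsto_spectralPow_of_normPow_add hα hf hg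
      (fun m => hpoly (c m)) hh₀m hch
    have h1' := tendsto_symbolA_sub (N := N) (a := a) h1
    have hxm := fun m => hsymb.sub (hpoly (c m))
    have hxfin := spectralPow_lt_top_of_tendsto hα.le hxm (hsymb.sub hh₀m)
      (fun m => (hfin (c m)).1) h1'
    have hyfin := spectralPow_lt_top_of_tendsto hα.le (fun m => hpoly (c m)) hh₀m
      (fun m => (hfin (c m)).2) h2
    rw [estError_eq hα hf hg N a hh₀m]
    -- The exponent of `A_N ξ - Y` is the limit of those of `A_N ξ` minus the polynomial estimates
    -- `c m`; the remainders tend to zero in law.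
    refine le_stableNormPow hα0 hf hg (hsymb.sub hh₀m) hh₀m hxfin hyfin fun z => ?_
    have hexp := (tendsto_spectralRePow hα.le hxm (hsymb.sub hh₀m) h1' z).add
      (tendsto_spectralRePow hα.le (fun m => hpoly (c m)) hh₀m h2 z)
    have hexp' := (ENNReal.tendsto_toReal (ENNReal.add_lt_top.2
      ⟨spectralRePow_lt_top hα0.le hxfin z, spectralRePow_lt_top hα0.le hyfin z⟩).ne).comp hexp
    have hlim := (Complex.continuous_exp.tendsto _).comp
      ((Complex.continuous_ofReal.tendsto _).comp hexp').neg
    have hsm : ∀ m, Measurable fun ω =>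
        (z * (functionalA N a ξ ω - linComb (c m) (ξ + η) ω)).re := fun m =>
      Complex.measurable_re.comp (((measurable_functionalA N a hξm).sub
        (measurable_linComb _ hζm)).const_mul z)
    have htm : ∀ m, Measurable fun ω => (z * (linComb (c m) (ξ + η) ω - Y ω)).re := fun m =>
      Complex.measurable_re.comp (((measurable_linComb _ hζm).sub hYm).const_mul z)
    have hdiff := tendsto_charFun_sub hsm htm (tendsto_charFun_one hα0 hcY z)
    have hsum := hdiff.add (hlim.congr fun m => (hchar (c m) z).symm)
    simp only [sub_add_cancel, zero_add, ← Complex.add_re, ← mul_add,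
      sub_add_sub_cancel] at hsum
    exact tendsto_nhds_unique tendsto_const_nhds hsum
  exact hlower.trans (ge_of_tendsto'
    (tendsto_estError hα hf hg N a (fun m => hpoly (d m)) hhm hd) hupper)

end Estimates

end HSaS

/-! ### The saddle point argument -/

theorem mainTheorem11 {Ω : Type*} [MeasurableSpace Ω] (P : Measure Ω) [IsProbabilityMeasure P]
    (α : ℝ) (hα : 1 < α) (hα2 : α ≤ 2) (T N : ℕ) (a : ℕ → Fin T → ℂ)
    (Df Dg : Set (ℝ → Matrix (Fin T) (Fin T) ℂ))
    (hDf : ∀ f ∈ Df, HSaS.IsSpectralDensity α f)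
    (hDg : ∀ g ∈ Dg, HSaS.IsSpectralDensity α g)
    (ξ η : ℤ → Ω → Fin T → ℂ) (f₀ g₀ : ℝ → Matrix (Fin T) (Fin T) ℂ)
    (hξ : HSaS.IsHarmonizable α P ξ f₀) (hη : HSaS.IsHarmonizable α P η g₀)
    (hindep : IndepFun (fun ω n => ξ n ω) (fun ω n => η n ω) P)
    (hmin : HSaS.MinimalityCondition α f₀ g₀)
    (h₀ : ℝ → Fin T → ℂ)
    (hh₀ : HSaS.IsOptimalCharacteristic α P N a ξ η f₀ g₀ h₀)
    (hsol : HSaS.SolvesConstrained α N a Df Dg h₀ f₀ g₀)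
    (hH : h₀ ∈ HSaS.commonSpace α N Df Dg) :
    HSaS.IsLeastFavorable α N a Df Dg f₀ g₀ ∧
    HSaS.optimalError α N a f₀ g₀ = HSaS.estError α N a h₀ f₀ g₀ ∧
    HSaS.IsMinimaxCharacteristic α N a Df Dg h₀ := by
  obtain ⟨hf, hg, hmax⟩ := hsol
  -- Membership of `h₀` in `H_D` makes it admissible in the infimum, and optimality of the estimate
  -- supplies the reverse bound.
  have hopt : HSaS.optimalError α N a f₀ g₀ = HSaS.estError α N a h₀ f₀ g₀ :=
    le_antisymm (iInf₂_le h₀ (hH f₀ hf g₀ hg))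
      (le_iInf₂ fun _ hh => hh₀.estError_le hα hξ hη hindep hh)
  have hworst : HSaS.worstError α N a Df Dg h₀ = HSaS.estError α N a h₀ f₀ g₀ :=
    le_antisymm (iSup₂_le fun f hf' => iSup₂_le fun g hg' => hmax f hf' g hg')
      (le_iSup₂_of_le f₀ hf (le_iSup₂_of_le g₀ hg le_rfl))
  refine ⟨⟨hf, hg, fun f hf' g hg' => ?_⟩, hopt, hH, ⟨f₀, hf, g₀, hg, hworst⟩, fun h hh => ?_⟩
  -- `h₀` is admissible for every pair: `Δ(f, g) ≤ Δ(h₀; f, g) ≤ Δ(h₀; f₀, g₀) = Δ(f₀, g₀)`.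
  · exact (iInf₂_le h₀ (hH f hf' g hg')).trans (hopt ▸ hmax f hf' g hg')
  · rw [hworst]
    -- The worst error of any `h` in `H_D` is at least its error at `(f₀, g₀)`, where `h₀` is
    -- optimal.
    exact (hh₀.estError_le hα hξ hη hindep (hh f₀ hf g₀ hg)).trans
      (le_iSup₂_of_le f₀ hf (le_iSup₂_of_le g₀ hg le_rfl))
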